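/- An effect algebra is a set $E$ with elements $0\neq 1$ and a partial binary operation $\oplus$ such that, for all $x,y,z\in E$: $x\oplus y=y\oplus x$ if one side is defined; $(x\oplus y)\oplus z=x\oplus(y\oplus z)$ if one side is defined; there is a unique $x'\in E$ with $x\oplus x'=1$; and if $1\oplus x$ is defined then $x=0$. It is ordered by: $x\le y$ iff $x\oplus z=y$ for some $z\in E$. The algebra $E$ has the Riesz decomposition property if whenever $v_1\oplus v_2$ is defined and $u\le v_1\oplus v_2$, there are $u_1\le v_1$, $u_2\le v_2$ with $u=u_1\oplus u_2$; it is homogeneous if this holds whenever $u\le v_1\oplus v_2\le u'$. An element $x$ is sharp if $x\wedge x'$ exists and equals $0$; it is meager if $0$ is the only sharp element below $x$. $E$ is sharply dominating if every element has a least sharp element above it. The set $M(E)$ of meager elements, with $x\oplus y$ defined in $M(E)$ iff it is defined in $E$ and is meager, is a generalized effect algebra, ordered in the same way by its own operation. $E$ is meager-orthocomplete if $M(E)$ is orthocomplete: for every family $(x_i)_{i\in H}$ in $M(E)$ for which the sum $\bigoplus_{i\in K}x_i$ exists in $M(E)$ for all finite $K\subseteq H$, and for which these finite sums have a common upper bound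 in $M(E)$, the set of these finite sums has a supremum in $M(E)$. A sub-effect algebra of $E$ is a subset $Q\ni 1$ such that whenever $x\oplus y=z$ in $E$ and two of $x,y,z$ lie in $Q$, all three lie in $Q$; it is an effect algebra with the inherited operation. A block of $E$ is a maximal (with respect to inclusion) sub-effect algebra of $E$ with the Riesz decomposition property. **Theorem.** Let $E$ be a homogeneous, meager-orthocomplete, sharply dominating effect algebra and let $B$ be a block of $E$. Then $B$ is a lattice: any two elements of $B$ have a meet and a join in $B$. Moreover, every $y\in B$ has a unique decomposition $y=y_S\oplus y_M$ with $y_S\in E$ sharp in $E$ and $y_M\in E$ meager in $E$, and $y_S,y_M\in B$; and for all $y,z\in B$ the four meets below exist in $B$, the sum on the right is defined, and $$y\wedge_B z=(y_S\wedge_B z_S)\oplus(y_S\wedge_B z_M)\oplus(z_S\wedge_B y_M)\oplus(y_M\wedge_B z_M).$$ -/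

import Mathlib

universe u

/-- A set with a distinguished element `zero` and a partial binary operation:
`oplus x y = some z` means that `x ⊕ y` is defined and equals `z`, and
`oplus x y = none` means that `x ⊕ y` is not defined. -/
class PartialSum (E : Type u) where
  zero : E
  oplus : E → E → Option E

open PartialSum

/-- Generalized effect algebras. -/
class GenEffectAlgebra (E : Type u) extends PartialSum E where
  comm : ∀ x y : E, oplus x y = oplus y x
  assoc : ∀ x y z : E,
    (oplus x y).bind (fun s => oplus s z) = (oplus y z).bind (fun t => oplus x t)
  cancel : ∀ x y z s : E, oplus x y = some s → oplus x z = some s → y = z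
  pos : ∀ x y : E, oplus x y = some zero → x = zero ∧ y = zero
  sum_zero : ∀ x : E, oplus x zero = some x

/-- Effect algebras. -/
class EffectAlgebra (E : Type u) extends PartialSum E where
  one : E
  zero_ne_one : zero ≠ one
  comm : ∀ x y : E, oplus x y = oplus y x
  assoc : ∀ x y z : E,
    (oplus x y).bind (fun s => oplus s z) = (oplus y z).bind (fun t => oplus x t)
  existsUnique_compl : ∀ x : E, ∃! y : E, oplus x y = some one
  eq_zero_of_one_sum : ∀ x s : E, oplus one x = some s → x = zero

namespace GenEffectAlgebra

variable {E : Type u} [GenEffectAlgebra E]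

theorem assoc_left {x y z s w : E} (h₁ : oplus x y = some s) (h₂ : oplus s z = some w) :
    ∃ t, oplus y z = some t ∧ oplus x t = some w := by
  have h := assoc x y z
  rw [h₁, Option.bind_some, h₂] at h
  exact Option.bind_eq_some_iff.1 h.symm

/-- The order of a generalized effect algebra: `x ≤ y` iff `x ⊕ z = y` for some `z`. -/
instance (priority := 50) instPartialOrder : PartialOrder E where
  le x y := ∃ z, oplus x z = some y
  le_refl x := ⟨zero, sum_zero x⟩
  le_trans x y z := by
    rintro ⟨a, ha⟩ ⟨b, hb⟩
    obtain ⟨t, -, ht⟩ := assoc_left ha hb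
    exact ⟨t, ht⟩
  le_antisymm x y := by
    rintro ⟨a, ha⟩ ⟨b, hb⟩
    obtain ⟨t, ht, hxt⟩ := assoc_left ha hb
    have h0 : t = zero := cancel x t zero x hxt (sum_zero x)
    rw [h0] at ht
    rw [(pos a b ht).1, sum_zero] at ha
    exact Option.some.inj ha

theorem le_def {x y : E} : x ≤ y ↔ ∃ z, oplus x z = some y := Iff.rfl

/-- The operation `⊕` with undefinedness propagated. -/
def osum (a b : Option E) : Option E := a.bind fun x => b.bind fun y => oplus x y

instance : Std.Commutative (osum (E := E)) where
  comm a b := by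
    cases a <;> cases b <;> simp [osum, comm]

instance : Std.Associative (osum (E := E)) where
  assoc a b c := by
    cases a with
    | none => rfl
    | some x =>
      cases b with
      | none => rfl
      | some y =>
        cases c with
        | none => simp [osum]
        | some z => simpa [osum] using assoc x y z

/-- The sum of the subfamily of `x` indexed by the finite set `K` (`none` if undefined);
the empty sum is `zero`. -/
def finSum {H : Type u} (x : H → E) (K : Finset H) : Option E :=
  K.fold osum (some zero) (fun i => some (x i))

/-- A family is orthogonal if all its finite subfamilies have a sum. -/
def IsOrthogonal {H : Type u} (x : H → E) : Prop :=
  ∀ K : Finset H, ∃ s, finSum x K = some s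

/-- The set of the sums of the finite subfamilies of `x`. -/
def finSums {H : Type u} (x : H → E) : Set E :=
  {s | ∃ K : Finset H, finSum x K = some s}

/-- `s` is the orthogonal sum of the family `x`. -/
def IsOrthosum {H : Type u} (x : H → E) (s : E) : Prop :=
  IsLUB (finSums x) s

end GenEffectAlgebra

open GenEffectAlgebra in
/-- Every bounded orthogonal system is orthosummable. -/
def Orthocomplete (M : Type u) [GenEffectAlgebra M] : Prop :=
  ∀ (H : Type u) (x : H → M), IsOrthogonal x → BddAbove (finSums x) → ∃ s, IsOrthosum x s

namespace EffectAlgebra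

variable {E : Type u} [EffectAlgebra E]

theorem one_sum_zero : oplus (one : E) zero = some one := by
  obtain ⟨y, hy, -⟩ := existsUnique_compl (one : E)
  have h0 := eq_zero_of_one_sum y one hy
  rwa [h0] at hy

/-- Every effect algebra is a generalized effect algebra. -/
instance (priority := 50) toGen : GenEffectAlgebra E where
  comm := comm
  assoc := assoc
  cancel x y z s hy hz := by
    obtain ⟨c, hc, -⟩ := existsUnique_compl s
    have key : ∀ w : E, oplus x w = some s →
        (oplus x c).bind (fun t => oplus w t) = some one := by
      intro w hw
      rw [← assoc w x c, comm w x, hw, Option.bind_some, hc]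
    have ey := key y hy
    have ez := key z hz
    obtain ⟨t, ht, hyt⟩ := Option.bind_eq_some_iff.1 ey
    rw [ht, Option.bind_some] at ez
    rw [comm] at ez hyt
    exact (existsUnique_compl t).unique hyt ez
  pos x y h := by
    have key : ∀ x y : E, oplus x y = some zero → y = zero := by
      intro x y h
      have e := assoc x y one
      rw [h, Option.bind_some, comm, one_sum_zero] at e
      obtain ⟨t, ht, -⟩ := Option.bind_eq_some_iff.1 e.symm
      rw [comm] at ht
      exact eq_zero_of_one_sum y t ht
    exact ⟨key y x (by rw [comm]; exact h), key x y h⟩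
  sum_zero x := by
    obtain ⟨y, hy, -⟩ := existsUnique_compl x
    have e := assoc y x zero
    rw [comm y x, hy, Option.bind_some, one_sum_zero] at e
    obtain ⟨t, ht, hyt⟩ := Option.bind_eq_some_iff.1 e.symm
    rw [comm] at hy
    rw [ht, (existsUnique_compl y).unique hyt hy]

/-- The orthosupplement `x'`: the unique element with `x ⊕ x' = 1`. -/
noncomputable def compl (x : E) : E := (existsUnique_compl x).choose

theorem sum_compl (x : E) : oplus x (compl x) = some one :=
  (existsUnique_compl x).choose_spec.1

/-- `x` is sharp if the meet of `x` and `x'` exists and is `0`. -/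
def IsSharp (x : E) : Prop := IsGLB {x, compl x} (zero : E)

/-- `x` is meager if `0` is the only sharp element below it. -/
def IsMeager (x : E) : Prop := ∀ v : E, IsSharp v → v ≤ x → v = zero

/-- `x = s ⊕ m` with `s` sharp and `m` meager. -/
def IsSharpMeagerDecomp (x s m : E) : Prop :=
  IsSharp s ∧ IsMeager m ∧ oplus s m = some x

theorem IsMeager.mono {x y : E} (hy : IsMeager y) (h : x ≤ y) : IsMeager x :=
  fun v hv hvx => hy v hv (hvx.trans h)

theorem isMeager_zero : IsMeager (zero : E) := by
  rintro v - ⟨a, ha⟩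
  exact (GenEffectAlgebra.pos v a ha).1

end EffectAlgebra

open EffectAlgebra

/-! Restriction of the partial operation to a subset -/

open Classical in
/-- The restriction of `⊕` to a subset given by `P`: the sum of two elements is defined if it is
defined in `E` and satisfies `P`. -/
noncomputable def restrictSum {E : Type u} [PartialSum E] (P : E → Prop) (x y : Subtype P) :
    Option (Subtype P) :=
  (oplus x.1 y.1).bind fun s => if h : P s then some ⟨s, h⟩ else none

theorem restrictSum_eq_some {E : Type u} [PartialSum E] {P : E → Prop} {x y z : Subtype P} :
    restrictSum P x y = some z ↔ oplus x.1 y.1 = some z.1 := by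
  unfold restrictSum
  rw [Option.bind_eq_some_iff]
  constructor
  · rintro ⟨s, hs, h⟩
    split_ifs at h with hP
    rw [hs, ← Option.some.inj h]
  · intro h
    exact ⟨z.1, h, by rw [dif_pos z.2]⟩

theorem restrictSum_comm {E : Type u} [GenEffectAlgebra E] {P : E → Prop} (x y : Subtype P) :
    restrictSum P x y = restrictSum P y x := by
  unfold restrictSum
  rw [GenEffectAlgebra.comm]

theorem restrictSum_assoc {E : Type u} [GenEffectAlgebra E] {P : E → Prop}
    (hP : ∀ x y s z w : E, P x → P y → P z → P w → oplus x y = some s → oplus s z = some w → P s)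
    (x y z : Subtype P) :
    (restrictSum P x y).bind (fun s => restrictSum P s z) =
      (restrictSum P y z).bind (fun t => restrictSum P x t) := by
  ext w
  simp only [Option.bind_eq_some_iff, restrictSum_eq_some]
  constructor
  · rintro ⟨s, h₁, h₂⟩
    obtain ⟨t, ht, hw⟩ := GenEffectAlgebra.assoc_left h₁ h₂
    rw [GenEffectAlgebra.comm] at ht
    have hw' := hw
    rw [GenEffectAlgebra.comm] at hw'
    exact ⟨⟨t, hP _ _ _ _ _ z.2 y.2 x.2 w.2 ht hw'⟩, by rwa [GenEffectAlgebra.comm], hw⟩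
  · rintro ⟨t, h₁, h₂⟩
    rw [GenEffectAlgebra.comm] at h₁ h₂
    obtain ⟨s, hs, hw⟩ := GenEffectAlgebra.assoc_left h₁ h₂
    rw [GenEffectAlgebra.comm] at hs hw
    exact ⟨⟨s, hP _ _ _ _ _ x.2 y.2 z.2 w.2 hs hw⟩, hs, hw⟩

/-- The set of meager elements of `E`, as a type of its own. -/
def MeagerElem (E : Type u) [EffectAlgebra E] : Type u := Subtype (IsMeager (E := E))

/-- The meager elements, with the restriction of `⊕`, form a generalized effect algebra. -/
noncomputable instance MeagerElem.instGen (E : Type u) [EffectAlgebra E] :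
    GenEffectAlgebra (MeagerElem E) where
  zero := ⟨zero, isMeager_zero⟩
  oplus := restrictSum _
  comm := restrictSum_comm
  assoc := restrictSum_assoc fun _ _ _ z _ _ _ _ hw _ h => hw.mono ⟨z, h⟩
  cancel x y z s hy hz :=
    Subtype.ext (GenEffectAlgebra.cancel _ _ _ _
      (restrictSum_eq_some.1 hy) (restrictSum_eq_some.1 hz))
  pos x y h := by
    have := GenEffectAlgebra.pos _ _ (restrictSum_eq_some.1 h)
    exact ⟨Subtype.ext this.1, Subtype.ext this.2⟩
  sum_zero x := restrictSum_eq_some.2 (GenEffectAlgebra.sum_zero x.1)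

/-- The generalized effect algebra of meager elements is orthocomplete. -/
def MeagerOrthocomplete (E : Type u) [EffectAlgebra E] : Prop :=
  Orthocomplete (MeagerElem E)

/-- Every element has a smallest sharp element above it. -/
def SharplyDominating (E : Type u) [EffectAlgebra E] : Prop :=
  ∀ x : E, ∃ s : E, IsLeast {v : E | IsSharp v ∧ x ≤ v} s

/-- If `u ≤ v₁ ⊕ v₂ ≤ u'`, then `u = u₁ ⊕ u₂` for some `u₁ ≤ v₁`, `u₂ ≤ v₂`. -/
def Homogeneous (E : Type u) [EffectAlgebra E] : Prop :=
  ∀ u v₁ v₂ v : E, oplus v₁ v₂ = some v → u ≤ v → v ≤ compl u →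
    ∃ u₁ u₂ : E, u₁ ≤ v₁ ∧ u₂ ≤ v₂ ∧ oplus u₁ u₂ = some u

/-- The Riesz decomposition property. -/
def HasRDP (E : Type u) [EffectAlgebra E] : Prop :=
  ∀ u v₁ v₂ v : E, oplus v₁ v₂ = some v → u ≤ v →
    ∃ u₁ u₂ : E, u₁ ≤ v₁ ∧ u₂ ≤ v₂ ∧ oplus u₁ u₂ = some u

/-- Sub-effect algebras. -/
structure SubEffectAlgebra (E : Type u) [EffectAlgebra E] where
  carrier : Set E
  one_mem : one ∈ carrier
  two_of_three : ∀ x y z : E, oplus x y = some z →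
    (x ∈ carrier ∧ y ∈ carrier) ∨ (x ∈ carrier ∧ z ∈ carrier) ∨ (y ∈ carrier ∧ z ∈ carrier) →
    x ∈ carrier ∧ y ∈ carrier ∧ z ∈ carrier

namespace SubEffectAlgebra

variable {E : Type u} [EffectAlgebra E]

/-- Sub-effect algebras are ordered by inclusion. -/
instance : LE (SubEffectAlgebra E) := ⟨fun Q R => Q.carrier ⊆ R.carrier⟩

/-- The elements of a sub-effect algebra, as a type of its own. -/
def Elem (Q : SubEffectAlgebra E) : Type u := Subtype (fun x : E => x ∈ Q.carrier)

/-- The inclusion of a sub-effect algebra. -/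
def Elem.val {Q : SubEffectAlgebra E} (x : Q.Elem) : E := Subtype.val x

theorem zero_mem (Q : SubEffectAlgebra E) : (zero : E) ∈ Q.carrier :=
  (Q.two_of_three _ _ _ one_sum_zero (Or.inr (Or.inl ⟨Q.one_mem, Q.one_mem⟩))).2.1

/-- A sub-effect algebra with the inherited operation is an effect algebra; its order is the one
defined by its own operation. -/
noncomputable instance (Q : SubEffectAlgebra E) : EffectAlgebra Q.Elem where
  zero := ⟨zero, Q.zero_mem⟩
  one := ⟨one, Q.one_mem⟩
  oplus := restrictSum _
  zero_ne_one h := zero_ne_one (Subtype.ext_iff.1 h)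
  comm := restrictSum_comm
  assoc := restrictSum_assoc fun _ _ _ _ _ hx hy _ _ h _ =>
    (Q.two_of_three _ _ _ h (Or.inl ⟨hx, hy⟩)).2.2
  existsUnique_compl x := by
    refine ⟨⟨compl x.1, (Q.two_of_three _ _ _ (sum_compl x.1)
      (Or.inr (Or.inl ⟨x.2, Q.one_mem⟩))).2.1⟩, restrictSum_eq_some.2 (sum_compl x.1), ?_⟩
    intro y hy
    exact Subtype.ext ((existsUnique_compl x.1).unique (restrictSum_eq_some.1 hy) (sum_compl x.1))
  eq_zero_of_one_sum x s h :=
    Subtype.ext (eq_zero_of_one_sum x.1 s.1 (restrictSum_eq_some.1 h))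

/-- Blocks: maximal sub-effect algebras with the Riesz decomposition property. -/
def IsBlock (B : SubEffectAlgebra E) : Prop :=
  Maximal (fun Q : SubEffectAlgebra E => HasRDP Q.Elem) B

end SubEffectAlgebra

/-- A partial order in which any two elements have a meet and a join. -/
def IsLatticeOrder (L : Type u) [PartialOrder L] : Prop :=
  ∀ y z : L, (∃ m, IsGLB {y, z} m) ∧ (∃ j, IsLUB {y, z} j)

/-! Every element is `x = x_S ⊕ x_M`: the greatest sharp element below `x` is the complement of the
least sharp element above `x'`, and homogeneity makes the remainder meager. The main point is that a
block `B` contains, with `y`, both `y_S` and everything below `y_M` (`IsBlock.mem_of_decomp`). Then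
meets with a sharp `s` come from splitting along `s ⊕ s' = 1`; two meager parts have a maximal
common lower bound by Zorn's lemma, which lies in `B` and is a meet by Riesz interpolation. The four
meets add up to `y ∧ z`, and complements give joins.

For the main point, `B` is enlarged. Cut the entries of a partition of `1` in `B` into their sharp
parts and arbitrary finite pieces of their meager parts. The partial sums of these good partitions
contain `B` and the elements wanted; they form a sub-effect algebra with the Riesz decomposition
property, so by maximality they lie in `B`. This works because the partial sums of two good
partitions are partial sums of a third (`Good.exists_covers`), and homogeneity makes orthogonal
partial sums disjoint (`Good.exists_disjoint`).

Both facts rest on a stronger form of homogeneity, `IsSmall.split`: any `d ≤ p_M` splits along every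
`p = v₁ ⊕ v₂`, even if `p ≤ d'` fails. Below each nonzero part of `d` there is a nonzero element
orthogonal to `p` (`Homogeneous.exists_le_compl`); homogeneity splits that element, and Zorn's lemma
exhausts `d`. The chains involved have suprema because orthocompleteness passes from families to
bounded chains. -/

open GenEffectAlgebra

/-! ### Partial sums in a commutative monoid with an absorbing undefined element -/

/-- The carrier with an additional element for undefined sums, as a commutative monoid. -/
def OSum (E : Type u) : Type u := Option E

namespace OSum

variable {E : Type u}

/-- The inclusion of the defined sums. -/
@[coe] def of (x : E) : OSum E := some x

instance : Coe E (OSum E) := ⟨of⟩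

theorem of_injective {a b : E} (h : (a : OSum E) = b) : a = b := Option.some.inj h

variable [GenEffectAlgebra E]

instance : Zero (OSum E) := ⟨of zero⟩

instance : Add (OSum E) := ⟨osum⟩

instance : AddCommMonoid (OSum E) where
  add_assoc := Std.Associative.assoc (op := osum (E := E))
  add_comm := Std.Commutative.comm (op := osum (E := E))
  zero_add a := by
    cases a with
    | none => rfl
    | some x => exact (GenEffectAlgebra.comm _ _).trans (GenEffectAlgebra.sum_zero x)
  add_zero a := by
    cases a with
    | none => rfl
    | some x => exact GenEffectAlgebra.sum_zero x
  nsmul := nsmulRec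

theorem coe_zero : ((zero : E) : OSum E) = 0 := rfl

theorem add_eq_coe {a b c : E} : (a : OSum E) + b = c ↔ oplus a b = some c := Iff.rfl

theorem exists_of_add {p q : OSum E} {c : E} (h : p + q = c) :
    ∃ a b : E, p = a ∧ q = b := by
  cases p with
  | none => cases h
  | some a =>
    cases q with
    | none => cases h
    | some b => exact ⟨a, b, rfl, rfl⟩

theorem exists_left {p q : OSum E} {c : E} (h : p + q = c) : ∃ a : E, p = a := by
  obtain ⟨a, b, ha, -⟩ := exists_of_add h
  exact ⟨a, ha⟩

theorem exists_right {p q : OSum E} {c : E} (h : p + q = c) : ∃ a : E, q = a := by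
  obtain ⟨a, b, -, hb⟩ := exists_of_add h
  exact ⟨b, hb⟩

theorem cancel {p q r : OSum E} {c : E} (h₁ : p + q = c) (h₂ : p + r = c) : q = r := by
  obtain ⟨a, b, rfl, rfl⟩ := exists_of_add h₁
  obtain ⟨-, d, -, rfl⟩ := exists_of_add h₂
  rw [GenEffectAlgebra.cancel a b d c h₁ h₂]

theorem le_iff {x y : E} : x ≤ y ↔ ∃ z : E, (x : OSum E) + z = y := Iff.rfl

theorem le_of_add {x y : E} {p : OSum E} (h : (x : OSum E) + p = y) : x ≤ y := by
  obtain ⟨b, rfl⟩ := exists_right h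
  exact ⟨b, h⟩

theorem le_of_add' {x y : E} {p : OSum E} (h : p + x = y) : x ≤ y :=
  le_of_add (p := p) (by rw [add_comm, h])

theorem zero_le (x : E) : zero ≤ x := le_of_add (p := x) (zero_add _)

theorem le_zero {x : E} (h : x ≤ zero) : x = zero := le_antisymm h (zero_le x)

/-- A lower bound of one summand can be cancelled from an inequality. -/
theorem le_of_add_le_add {a x y s t : E} (hs : (a : OSum E) + x = s) (ht : (a : OSum E) + y = t)
    (h : s ≤ t) : x ≤ y := by
  obtain ⟨w, hw⟩ := le_iff.1 h
  rw [← hs, add_assoc] at hw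
  exact le_of_add (p := w) (cancel hw ht)

/-- Sums of smaller elements exist and are smaller. -/
theorem exists_add_of_le {a b x y t : E} (ha : a ≤ x) (hb : b ≤ y) (ht : (x : OSum E) + y = t) :
    ∃ s : E, (a : OSum E) + b = s ∧ s ≤ t := by
  obtain ⟨c, hc⟩ := le_iff.1 ha
  obtain ⟨d, hd⟩ := le_iff.1 hb
  have h : ((a : OSum E) + b) + (c + d) = t := by
    rw [← ht, ← hc, ← hd]; abel
  obtain ⟨s, hs⟩ := exists_left h
  exact ⟨s, hs, le_of_add (p := (c : OSum E) + d) (by rw [← hs, h])⟩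

theorem add_left_eq {a b : E} {p : OSum E} (h : (a : OSum E) + p = b) (hab : a = b) :
    p = 0 := by
  subst hab
  exact cancel h (add_zero _)

theorem finSum_eq {H : Type u} (x : H → E) (K : Finset H) :
    finSum x K = ∑ i ∈ K, (x i : OSum E) := by
  classical
  induction K using Finset.induction_on with
  | empty => rfl
  | insert a K ha ih =>
    rw [Finset.sum_insert ha, ← ih]
    exact Finset.fold_insert ha

end OSum

open OSum

/-! ### Suprema of bounded chains from orthocompleteness -/

section Chains

variable {M : Type u} [GenEffectAlgebra M]

/-- The increments `d a` of `f a` over the supremum `g a` of the earlier values form an orthogonal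
family, whose sum is the supremum of `f`. -/
theorem Orthocomplete.exists_isLUB_range_of_Iio (hM : Orthocomplete M) {ι : Type u}
    [LinearOrder ι] [WellFoundedLT ι] {f : ι → M} (hf : Monotone f) (hb : BddAbove (Set.range f))
    (h : ∀ a, ∃ g, IsLUB (f '' Set.Iio a) g) : ∃ s, IsLUB (Set.range f) s := by
  choose g hg using h
  have hgf : ∀ a, g a ≤ f a := fun a => (hg a).2 (by
    rintro _ ⟨b, hb, rfl⟩
    exact hf (le_of_lt hb))
  choose d hd using fun a => le_iff.1 (hgf a)
  have key : ∀ K : Finset ι, ∃ s : M, ∑ i ∈ K, (d i : OSum M) = s ∧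
      ∀ t, (∀ b ∈ K, f b ≤ t) → s ≤ t := by
    intro K
    induction K using Finset.induction_on_max with
    | empty => exact ⟨zero, rfl, fun t _ => zero_le t⟩
    | insert a K ha ih =>
      obtain ⟨s, hs, hst⟩ := ih
      have hsg : s ≤ g a := hst _ fun b hb => (hg a).1 ⟨b, ha b hb, rfl⟩
      obtain ⟨r, hr, hrf⟩ := exists_add_of_le hsg (le_refl (d a)) (hd a)
      refine ⟨r, ?_, fun t ht => hrf.trans (ht a (Finset.mem_insert_self _ _))⟩
      rw [Finset.sum_insert fun hK => lt_irrefl _ (ha a hK), hs, add_comm, hr]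
  obtain ⟨v, hv⟩ := hb
  have hle : ∀ t, (∀ a, f a ≤ t) → t ∈ upperBounds (finSums d) := by
    rintro t ht s ⟨K, hK⟩
    rw [finSum_eq] at hK
    obtain ⟨r, hr, hrt⟩ := key K
    rw [hr] at hK
    rw [← of_injective hK]
    exact hrt t fun b _ => ht b
  obtain ⟨s, hs⟩ := hM ι d
    (fun K => by
      obtain ⟨r, hr, -⟩ := key K
      exact ⟨r, (finSum_eq d K).trans hr⟩)
    ⟨v, hle v fun a => hv ⟨a, rfl⟩⟩
  refine ⟨s, ?_, fun t ht => hs.2 (hle t fun a => ht ⟨a, rfl⟩)⟩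
  -- Quantifying over `t` lets the induction pass to the difference `t'` of `t` and `d a`, which
  -- bounds the finite sums with indices below `a`.
  have main : ∀ a t, (∀ K : Finset ι, (∀ b ∈ K, b ≤ a) → ∀ r : M,
      ∑ i ∈ K, (d i : OSum M) = r → r ≤ t) → f a ≤ t := by
    intro a
    induction a using WellFoundedLT.induction with
    | ind a ih =>
      intro t ht
      have hdt : d a ≤ t := ht {a} (by simp) _ (Finset.sum_singleton _ _)
      obtain ⟨t', ht'⟩ := le_iff.1 hdt
      have hgt : g a ≤ t' := (hg a).2 (by
        rintro _ ⟨b, hb, rfl⟩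
        refine ih b hb t' fun K hK r hr => ?_
        have haK : a ∉ K := fun haK => absurd (hK a haK) (not_le.2 hb)
        obtain ⟨q, hq, -⟩ := key (insert a K)
        have hqt : q ≤ t := by
          refine ht _ (fun c hc => ?_) q hq
          rcases Finset.mem_insert.1 hc with rfl | hc
          · exact le_rfl
          · exact (hK c hc).trans (le_of_lt hb)
        rw [Finset.sum_insert haK, hr] at hq
        exact le_of_add_le_add hq ht' hqt)
      obtain ⟨w, hw, hwt⟩ := exists_add_of_le hgt (le_refl (d a)) (by rw [add_comm, ht'])
      rw [hd] at hw
      rw [of_injective hw]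
      exact hwt
  rintro _ ⟨a, rfl⟩
  exact main a s fun K _ r hr => hs.1 ⟨K, (finSum_eq d K).trans hr⟩

theorem Orthocomplete.exists_isLUB_range (hM : Orthocomplete M) {ι : Type u}
    [LinearOrder ι] [WellFoundedLT ι] {f : ι → M} (hf : Monotone f)
    (hb : BddAbove (Set.range f)) : ∃ s, IsLUB (Set.range f) s := by
  refine hM.exists_isLUB_range_of_Iio hf hb fun a => ?_
  induction a using WellFoundedLT.induction with
  | ind a ih =>
    have hr : f '' Set.Iio a = Set.range (fun x : Set.Iio a => f x) := by
      ext y; simp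
    rw [hr]
    refine hM.exists_isLUB_range_of_Iio (ι := Set.Iio a) (fun x y h => hf h)
      (hb.mono (by rintro _ ⟨x, rfl⟩; exact ⟨x, rfl⟩)) fun b => ?_
    have hb' : (fun x : Set.Iio a => f x) '' Set.Iio b = f '' Set.Iio b.1 := by
      ext y
      constructor
      · rintro ⟨x, hx, rfl⟩
        exact ⟨x.1, hx, rfl⟩
      · rintro ⟨x, hx, rfl⟩
        exact ⟨⟨x, lt_trans hx b.2⟩, hx, rfl⟩
    rw [hb']
    exact ih b.1 b.2

/-- In an orthocomplete generalized effect algebra, bounded chains have suprema. -/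
theorem Orthocomplete.exists_isLUB_of_isChain (hM : Orthocomplete M) {C : Set M}
    (hC : IsChain (· ≤ ·) C) (hb : BddAbove C) : ∃ s, IsLUB C s := by
  classical
  have hwf : WellFounded (WellOrderingRel (α := M)) := WellOrderingRel.isWellOrder.wf
  -- The elements of `C` above all their predecessors in a well-ordering of `M` form a well-ordered
  -- cofinal part of `C`.
  let S : Set M := {a | a ∈ C ∧ ∀ b ∈ C, WellOrderingRel b a → b < a}
  have hcof : ∀ c ∈ C, ∃ a ∈ S, c ≤ a := by
    intro c hc
    have hne : {a | a ∈ C ∧ c ≤ a}.Nonempty := ⟨c, hc, le_rfl⟩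
    obtain ⟨haC, hca⟩ := hwf.min_mem _ hne
    refine ⟨_, ⟨haC, fun b hbC hba => ?_⟩, hca⟩
    have hnb : ¬ c ≤ b := fun h => hwf.not_lt_min (x := b) {a | a ∈ C ∧ c ≤ a} ⟨hbC, h⟩ hba
    have hbc : b ≤ c := (hC.total hbC hc).resolve_right hnb
    exact lt_of_lt_of_le (lt_of_le_not_ge hbc hnb) hca
  let _ : LinearOrder S :=
    { (inferInstance : PartialOrder S) with
      le_total := fun a b => hC.total a.2.1 b.2.1
      toDecidableLE := Classical.decRel _ }
  have : WellFoundedLT S := by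
    have hwf' : WellFounded (fun a b : S => WellOrderingRel a.1 b.1) :=
      InvImage.wf _ hwf
    refine ⟨Subrelation.wf (fun {a b} hab => ?_) hwf'⟩
    rcases trichotomous_of (WellOrderingRel (α := M)) a.1 b.1 with h | h | h
    · exact h
    · exact absurd (Subtype.ext h) (ne_of_lt hab)
    · exact absurd (a.2.2 _ b.2.1 h) (not_lt_of_gt hab)
  obtain ⟨s, hs⟩ := hM.exists_isLUB_range (ι := S) (f := Subtype.val) (fun _ _ h => h)
    (hb.mono (by rintro _ ⟨x, rfl⟩; exact x.2.1))
  refine ⟨s, fun c hc => ?_, fun t ht => hs.2 ?_⟩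
  · obtain ⟨a, ha, hca⟩ := hcof c hc
    exact hca.trans (hs.1 ⟨⟨a, ha⟩, rfl⟩)
  · rintro _ ⟨x, rfl⟩
    exact ht x.2.1

end Chains

/-! ### Sharp and meager elements in homogeneous effect algebras -/

section Basic

variable {E : Type u} [EffectAlgebra E]

namespace EffectAlgebra

theorem coe_add_compl (x : E) : (x : OSum E) + compl x = (one : E) := sum_compl x

theorem eq_compl_of_add {x y : E} (h : (x : OSum E) + y = (one : E)) : y = compl x :=
  of_injective (cancel h (coe_add_compl x))

theorem compl_invol (x : E) : compl (compl x) = x :=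
  (eq_compl_of_add (by rw [add_comm, coe_add_compl])).symm

theorem le_one (x : E) : x ≤ one := le_of_add (coe_add_compl x)

/-- The complement of a summand. -/
theorem coe_compl_of_add {a v : E} {p : OSum E} (h : (a : OSum E) + p = v) :
    (↑(compl a) : OSum E) = compl v + p := by
  obtain ⟨b, rfl⟩ := exists_right h
  have h1 : (a : OSum E) + (compl v + b) = (one : E) := by
    rw [← coe_add_compl v, ← h]; abel
  exact cancel (coe_add_compl a) h1

theorem le_compl_of_add {x y c : E} (h : (x : OSum E) + y = c) : x ≤ compl y := by
  rw [add_comm] at h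
  exact le_of_add' (coe_compl_of_add h).symm

theorem exists_add_of_le_compl {x y : E} (h : x ≤ compl y) : ∃ c : E, (x : OSum E) + y = c := by
  obtain ⟨z, hz⟩ := le_iff.1 h
  have h1 : ((x : OSum E) + y) + z = (one : E) := by
    rw [← coe_add_compl y, ← hz]; abel
  exact exists_left h1

theorem compl_le_compl {x y : E} (h : x ≤ y) : compl y ≤ compl x := by
  obtain ⟨z, hz⟩ := le_iff.1 h
  exact le_of_add (coe_compl_of_add hz).symm

theorem le_compl_comm {x y : E} (h : x ≤ compl y) : y ≤ compl x := by
  have := compl_le_compl h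
  rwa [compl_invol] at this

theorem isSharp_iff {x : E} : IsSharp x ↔ ∀ r : E, r ≤ x → r ≤ compl x → r = zero := by
  constructor
  · intro h r h1 h2
    exact le_zero (h.2 (by rintro _ (rfl | rfl) <;> assumption))
  · intro h
    exact ⟨fun _ _ => zero_le _, fun r hr => (h r (hr (by simp)) (hr (by simp))).le⟩

theorem IsSharp.compl {x : E} (h : IsSharp x) : IsSharp (compl x) := by
  rw [isSharp_iff] at h ⊢
  intro r h1 h2
  rw [compl_invol] at h2
  exact h r h2 h1

theorem IsSharp.eq_zero_of_isMeager {x : E} (h : IsSharp x) (h' : IsMeager x) : x = zero :=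
  h' x h le_rfl

theorem isMeager_of_le_of_le_compl {d p : E} (h : d ≤ p) (h' : p ≤ compl d) : IsMeager d :=
  fun r hr hrd => isSharp_iff.1 hr r le_rfl ((hrd.trans (h.trans h')).trans (compl_le_compl hrd))

end EffectAlgebra

theorem Homogeneous.split (hhom : Homogeneous E) {u v₁ v₂ v : E} (hv : (v₁ : OSum E) + v₂ = v)
    (h : u ≤ v) (h' : v ≤ compl u) :
    ∃ u₁ u₂ : E, u₁ ≤ v₁ ∧ u₂ ≤ v₂ ∧ (u₁ : OSum E) + u₂ = u :=
  hhom u v₁ v₂ v hv h h'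

/-- An `r` below `d` and `d' = s ⊕ t'` splits into a part below `s` and a part below `t'`. As `r ≤
d`, the first is also below `s'` and the second below `t`, so both vanish. -/
theorem Homogeneous.isSharp_sub (hhom : Homogeneous E) {s t d : E} (hs : IsSharp s)
    (ht : IsSharp t) (h : (s : OSum E) + d = t) : IsSharp d := by
  rw [isSharp_iff]
  intro r hrd hrd'
  have h1 : (s : OSum E) + compl t = compl d := by
    rw [add_comm] at h
    rw [coe_compl_of_add h, add_comm]
  obtain ⟨a, b, ha, hb, hab⟩ := hhom.split h1 hrd' (compl_le_compl hrd)
  have ha0 : a = zero := by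
    refine isSharp_iff.1 hs a ha ?_
    exact ((le_of_add hab).trans hrd).trans (le_compl_comm (le_compl_of_add h))
  have hb0 : b = zero :=
    isSharp_iff.1 ht b (((le_of_add' hab).trans hrd).trans (le_of_add' h)) hb
  rw [ha0, hb0, coe_zero, zero_add] at hab
  exact (of_injective hab).symm

theorem Homogeneous.isSharp_add (hhom : Homogeneous E) {s t w : E} (hs : IsSharp s)
    (ht : IsSharp t) (h : (s : OSum E) + t = w) : IsSharp w := by
  have h1 : (t : OSum E) + compl w = compl s := by rw [coe_compl_of_add h, add_comm]
  have := (hhom.isSharp_sub ht hs.compl h1).compl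
  rwa [compl_invol] at this

/-- In a homogeneous effect algebra, sharp elements are principal. -/
theorem Homogeneous.add_le_of_isSharp (hhom : Homogeneous E) {s a b c : E} (hs : IsSharp s)
    (ha : a ≤ s) (hb : b ≤ s) (hab : a ≤ b) (h : (a : OSum E) + b = c) : c ≤ s := by
  obtain ⟨d, hd⟩ := le_iff.1 hb
  have h1 : (↑(compl s) : OSum E) + d = compl b := (coe_compl_of_add hd).symm
  -- Homogeneity needs `b' ≤ a'`, which is where `a ≤ b` enters.
  obtain ⟨x, y, hx, hy, hxy⟩ := hhom.split h1 (le_compl_of_add h) (compl_le_compl hab)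
  have hx0 : x = zero := isSharp_iff.1 hs x ((le_of_add hxy).trans ha) hx
  rw [hx0, coe_zero, zero_add] at hxy
  rw [of_injective hxy] at hy
  obtain ⟨w, hw, hws⟩ := exists_add_of_le hy (le_refl b) (by rw [add_comm, hd])
  rw [h] at hw
  rwa [of_injective hw]

theorem MeagerElem.le_iff {x y : MeagerElem E} : x ≤ y ↔ x.1 ≤ y.1 := by
  constructor
  · rintro ⟨z, hz⟩
    exact ⟨z.1, restrictSum_eq_some.1 hz⟩
  · rintro ⟨z, hz⟩
    exact ⟨⟨z, y.2.mono (le_of_add' (add_eq_coe.2 hz))⟩, restrictSum_eq_some.2 hz⟩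

/-- The supremum is formed in `M(E)`, so it is compared with meager upper bounds only. -/
theorem MeagerOrthocomplete.exists_lub (hmea : MeagerOrthocomplete E) {C : Set E}
    (hC : IsChain (· ≤ ·) C) {v : E} (hv : IsMeager v) (hCv : ∀ c ∈ C, c ≤ v) :
    ∃ s : E, s ≤ v ∧ (∀ c ∈ C, c ≤ s) ∧ ∀ t : E, IsMeager t → (∀ c ∈ C, c ≤ t) → s ≤ t := by
  let C' : Set (MeagerElem E) := {x | x.1 ∈ C}
  have hC' : IsChain (· ≤ ·) C' := by
    intro x hx y hy _
    rcases hC.total hx hy with h | h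
    · exact Or.inl (MeagerElem.le_iff.2 h)
    · exact Or.inr (MeagerElem.le_iff.2 h)
  have hb : (⟨v, hv⟩ : MeagerElem E) ∈ upperBounds C' :=
    fun x hx => MeagerElem.le_iff.2 (hCv _ hx)
  obtain ⟨s, hs⟩ := Orthocomplete.exists_isLUB_of_isChain hmea hC' ⟨_, hb⟩
  refine ⟨s.1, MeagerElem.le_iff.1 (hs.2 hb), fun c hc => ?_, fun t ht hct => ?_⟩
  · let c' : MeagerElem E := ⟨c, hv.mono (hCv c hc)⟩
    have hcs : c' ≤ s := hs.1 hc
    exact MeagerElem.le_iff.1 hcs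
  · let t' : MeagerElem E := ⟨t, ht⟩
    have hst : s ≤ t' := hs.2 fun x hx => MeagerElem.le_iff.2 (hct _ hx)
    exact MeagerElem.le_iff.1 hst

/-- Below a meager `v`, every nonzero `u` has a nonzero lower bound in common with `v'`. -/
theorem Homogeneous.exists_le_compl (hhom : Homogeneous E) (hmea : MeagerOrthocomplete E)
    {u v : E} (hv : IsMeager v) (huv : u ≤ v) (hu : u ≠ zero) :
    ∃ h : E, h ≤ u ∧ h ≠ zero ∧ h ≤ compl v := by
  by_contra hcon
  push Not at hcon
  let T : Set E := {t | t ≤ v ∧ ∀ q, q ≤ t → q ≤ compl v → q = zero}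
  have huT : u ∈ T := ⟨huv, fun q hq hqv => by
    by_contra h0
    exact hcon q hq h0 hqv⟩
  obtain ⟨t, hut, ht⟩ := zorn_le_nonempty₀ T (by
    intro C hCT hC _ _
    obtain ⟨s, hsv, hCs, hs⟩ := hmea.exists_lub hC hv fun c hc => (hCT hc).1
    refine ⟨s, ⟨hsv, fun q hqs hqv => ?_⟩, hCs⟩
    obtain ⟨r, hr⟩ := le_iff.1 hqs
    have hrs : r ≤ s := le_of_add' hr
    -- Each `c` in the chain contains no part of `q`, hence lies below `r`, the difference of `s`
    -- and `q`. So does the supremum, and `q` vanishes.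
    have hle : s ≤ r := by
      refine hs r (hv.mono (hrs.trans hsv)) fun c hc => ?_
      obtain ⟨d, hd⟩ := le_iff.1 (hCs c hc)
      obtain ⟨a, b, ha, hb, hab⟩ := hhom.split hd hqs (hsv.trans (le_compl_comm hqv))
      have ha0 : a = zero := (hCT hc).2 a ha ((le_of_add hab).trans hqv)
      rw [ha0, coe_zero, zero_add] at hab
      rw [of_injective hab] at hb
      obtain ⟨e, he⟩ := le_iff.1 hb
      refine le_of_add (p := (e : OSum E)) (cancel (p := (q : OSum E)) (c := s) ?_ hr)
      rw [← hd, ← he]; abel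
    rw [le_antisymm hle hrs, add_comm] at hr
    exact of_injective (cancel hr (add_zero _))) u huT
  have htT : t ∈ T := ht.prop
  -- An `r` below `t` and `t' = v' ⊕ d` must lie below `d`. Then `t ⊕ r` is again in `T`, and
  -- maximality gives `r = 0`.
  have htsharp : IsSharp t := by
    rw [isSharp_iff]
    intro r hrt hrt'
    obtain ⟨d, hd⟩ := le_iff.1 htT.1
    obtain ⟨a, b, ha, hb, hab⟩ :=
      hhom.split (coe_compl_of_add hd).symm hrt' (compl_le_compl hrt)
    have ha0 : a = zero := htT.2 a ((le_of_add hab).trans hrt) ha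
    rw [ha0, coe_zero, zero_add] at hab
    rw [of_injective hab] at hb
    obtain ⟨w, hw, hwv⟩ := exists_add_of_le (le_refl t) hb hd
    have hwT : w ∈ T := by
      refine ⟨hwv, fun q hqw hqv => ?_⟩
      obtain ⟨x, y, hx, hy, hxy⟩ := hhom.split hw hqw (hwv.trans (le_compl_comm hqv))
      rw [htT.2 x hx ((le_of_add hxy).trans hqv),
        htT.2 y (hy.trans hrt) ((le_of_add' hxy).trans hqv), coe_zero, zero_add] at hxy
      exact (of_injective hxy).symm
    exact of_injective (add_left_eq hw (le_antisymm (le_of_add hw) (ht.le_of_ge hwT (le_of_add hw))))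
  exact hu (le_zero (hut.trans (hv t htsharp htT.1).le))

end Basic

/-! ### Decomposition into sharp and meager parts -/

section Decomposition

variable {E : Type u} [EffectAlgebra E]

namespace EffectAlgebra

theorem isSharpMeagerDecomp_iff {x s m : E} : IsSharpMeagerDecomp x s m ↔
    IsSharp s ∧ IsMeager m ∧ (s : OSum E) + m = x := Iff.rfl

end EffectAlgebra

theorem Homogeneous.exists_greatest_decomp (hhom : Homogeneous E) (hsd : SharplyDominating E)
    (x : E) : ∃ s m : E, IsSharpMeagerDecomp x s m ∧ ∀ w : E, IsSharp w → w ≤ x → w ≤ s := by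
  obtain ⟨v, ⟨hv, hxv⟩, hmin⟩ := hsd (compl x)
  have hvx : compl v ≤ x := by
    have := compl_le_compl hxv
    rwa [compl_invol] at this
  have hmax : ∀ w : E, IsSharp w → w ≤ x → w ≤ compl v := fun w hw hwx =>
    le_compl_comm (hmin ⟨hw.compl, compl_le_compl hwx⟩)
  obtain ⟨m, hm⟩ := le_iff.1 hvx
  refine ⟨compl v, m, ⟨hv.compl, fun w hw hwm => ?_, hm⟩, hmax⟩
  obtain ⟨c, hc, hcx⟩ := exists_add_of_le (le_refl (compl v)) hwm hm
  have hcv := hmax c (hhom.isSharp_add hv.compl hw hc) hcx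
  exact of_injective (add_left_eq hc (le_antisymm (le_of_add hc) hcv))

/-- The greatest sharp element below `x` exceeds any other sharp part by a sharp element below the
meager part, that is, by zero. -/
theorem Homogeneous.decomp_unique (hhom : Homogeneous E) (hsd : SharplyDominating E)
    {x s m s₁ m₁ : E} (h : IsSharpMeagerDecomp x s m) (h₁ : IsSharpMeagerDecomp x s₁ m₁) :
    s = s₁ ∧ m = m₁ := by
  obtain ⟨t, n, ⟨ht, hn, htn⟩, hmax⟩ := hhom.exists_greatest_decomp hsd x
  have key : ∀ s m : E, IsSharpMeagerDecomp x s m → s = t ∧ m = n := by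
    rintro s m ⟨hs, hm, hsm⟩
    obtain ⟨d, hd⟩ := le_iff.1 (hmax s hs (le_of_add (add_eq_coe.2 hsm)))
    have hm' : (d : OSum E) + n = m := by
      refine cancel (p := (s : OSum E)) (c := x) ?_ hsm
      rw [← add_assoc, hd]
      exact htn
    have hd0 := hm d (hhom.isSharp_sub hs ht hd) (le_of_add hm')
    rw [hd0, coe_zero] at hm' hd
    rw [zero_add] at hm'
    rw [add_zero] at hd
    exact ⟨of_injective hd, (of_injective hm').symm⟩
  obtain ⟨rfl, rfl⟩ := key s m h
  obtain ⟨rfl, rfl⟩ := key s₁ m₁ h₁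
  exact ⟨rfl, rfl⟩

end Decomposition

/-! ### Small elements and the strengthened homogeneity -/

section Small

variable {E : Type u} [EffectAlgebra E]

/-- `d` is a meager element below `p`, and below each nonzero part of `d` there is a nonzero
element orthogonal to `p`. -/
structure IsSmall (d p : E) : Prop where
  le : d ≤ p
  meager : IsMeager d
  exists_le : ∀ u : E, u ≤ d → u ≠ zero → ∃ h : E, h ≤ u ∧ h ≠ zero ∧ h ≤ compl p

theorem IsSmall.mono {d p d₁ p₁ : E} (h : IsSmall d p) (hd : d₁ ≤ d) (hp : p₁ ≤ p) (hdp : d₁ ≤ p₁) :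
    IsSmall d₁ p₁ where
  le := hdp
  meager := h.meager.mono hd
  exists_le u hu hu0 := by
    obtain ⟨x, hxu, hx0, hxp⟩ := h.exists_le u (hu.trans hd) hu0
    exact ⟨x, hxu, hx0, hxp.trans (compl_le_compl hp)⟩

/-- The hypothesis of homogeneity is the special case in which every part of `d` is itself
orthogonal to `p`. -/
theorem IsSmall.of_le_of_le_compl {d p : E} (h : d ≤ p) (h' : p ≤ compl d) : IsSmall d p where
  le := h
  meager := isMeager_of_le_of_le_compl h h'
  exists_le u hu hu0 := ⟨u, le_rfl, hu0, hu.trans (le_compl_comm h')⟩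

theorem IsSmall.eq_zero_of_isSharp {d p : E} (h : IsSmall d p) (hp : IsSharp p) : d = zero := by
  by_contra h0
  obtain ⟨x, hx, hx0, hxp⟩ := h.exists_le d le_rfl h0
  exact hx0 (isSharp_iff.1 hp x (hx.trans h.le) hxp)

/-- An `x ≤ u` orthogonal to `m` is orthogonal to `p` too, because `s'` is principal and contains `x
⊕ m`. Together with `IsSmall.le_meager_part`, small means lying below the meager part. -/
theorem Homogeneous.small_of_add (hhom : Homogeneous E) (hmea : MeagerOrthocomplete E)
    {s m p t : E} (hs : IsSharp s) (hm : IsMeager m) (h : (s : OSum E) + m = p) (ht : t ≤ m) :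
    IsSmall t p where
  le := ht.trans (le_of_add' h)
  meager := hm.mono ht
  exists_le u hu hu0 := by
    obtain ⟨x, hxu, hx0, hxm⟩ := hhom.exists_le_compl hmea hm (hu.trans ht) hu0
    refine ⟨x, hxu, hx0, ?_⟩
    have hxm' : x ≤ m := (hxu.trans hu).trans ht
    have hms : m ≤ compl s := le_compl_comm (le_compl_of_add h)
    obtain ⟨c, hc⟩ := exists_add_of_le_compl hxm
    have hcs := hhom.add_le_of_isSharp hs.compl (hxm'.trans hms) hms hxm' hc
    obtain ⟨e, he⟩ := exists_add_of_le_compl hcs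
    refine le_compl_of_add (c := e) ?_
    rw [← he, ← hc, ← h]; abel

/-- Take `c` maximal below `d` and `m`. A nonzero rest of `d` contains a nonzero `x` orthogonal to
`p`; homogeneity splits `x` along `s` and the rest of `m`, the part below `s` vanishes, and `c ⊕ x`
contradicts maximality. -/
theorem IsSmall.le_meager_part (hhom : Homogeneous E) (hmea : MeagerOrthocomplete E)
    {d p s m : E} (hd : IsSmall d p) (h : IsSharpMeagerDecomp p s m) : d ≤ m := by
  obtain ⟨hs, hm, hsm⟩ := isSharpMeagerDecomp_iff.1 h
  let T : Set E := {c | c ≤ d ∧ c ≤ m}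
  obtain ⟨c, -, hT⟩ := zorn_le_nonempty₀ T (by
    intro C hCT hC _ _
    obtain ⟨x, hxd, hCx, hx⟩ := hmea.exists_lub hC hd.meager fun c hc => (hCT hc).1
    exact ⟨x, ⟨hxd, hx m hm fun c hc => (hCT hc).2⟩, hCx⟩) zero ⟨zero_le _, zero_le _⟩
  obtain ⟨hcd, hcm⟩ := hT.prop
  obtain ⟨u, hu⟩ := le_iff.1 hcd
  by_cases hu0 : u = zero
  · rw [hu0, coe_zero, add_zero] at hu
    rwa [← of_injective hu]
  exfalso
  obtain ⟨m', hm'⟩ := le_iff.1 hcm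
  obtain ⟨e, he⟩ := le_iff.1 hd.le
  obtain ⟨x, hxu, hx0, hxp⟩ := hd.exists_le u (le_of_add' hu) hu0
  have h1 : (c : OSum E) + (s + m') = p := by
    rw [← hsm, ← hm']; abel
  have h2 : (c : OSum E) + (u + e) = p := by
    rw [← add_assoc, hu, he]
  obtain ⟨v, hv⟩ := exists_right h1
  rw [hv] at h1
  have huv : (u : OSum E) + e = v := OSum.cancel h2 h1
  obtain ⟨x₁, x₂, hx₁, hx₂, hx⟩ := hhom.split hv (hxu.trans (le_of_add huv))
    ((le_of_add' h1).trans (le_compl_comm hxp))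
  have hx₁0 : x₁ = zero := isSharp_iff.1 hs x₁ hx₁
    (((le_of_add hx).trans hxp).trans (compl_le_compl (le_of_add hsm)))
  rw [hx₁0, coe_zero, zero_add] at hx
  rw [of_injective hx] at hx₂
  obtain ⟨w, hw, hwm⟩ := exists_add_of_le (le_refl c) hx₂ hm'
  obtain ⟨w₁, hw₁, hwd⟩ := exists_add_of_le (le_refl c) hxu hu
  rw [hw] at hw₁
  rw [← of_injective hw₁] at hwd
  have hle := hT.le_of_ge (y := w) ⟨hwd, hwm⟩ (le_of_add hw)
  exact hx0 (of_injective (add_left_eq hw (le_antisymm (le_of_add hw) hle)))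

/-- A small element splits along each decomposition of the larger element. -/
theorem IsSmall.split (hhom : Homogeneous E) (hmea : MeagerOrthocomplete E)
    (hsd : SharplyDominating E) {d p v₁ v₂ : E}
    (hd : IsSmall d p) (h : (v₁ : OSum E) + v₂ = p) :
    ∃ d₁ d₂ : E, d₁ ≤ v₁ ∧ d₂ ≤ v₂ ∧ (d₁ : OSum E) + d₂ = d := by
  let T : Set (E × E) := {x | x.1 ≤ v₁ ∧ x.2 ≤ v₂ ∧ ∃ w : E, (x.1 : OSum E) + x.2 = w ∧ w ≤ d}
  have h0T : ((zero, zero) : E × E) ∈ T :=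
    ⟨zero_le _, zero_le _, zero, zero_add _, zero_le _⟩
  obtain ⟨⟨a, b⟩, -, hT⟩ := zorn_le_nonempty₀ T (by
    intro C hCT hC _ _
    have hC₁ : IsChain (· ≤ ·) (Prod.fst '' C) := by
      rintro _ ⟨x, hx, rfl⟩ _ ⟨y, hy, rfl⟩ _
      exact (hC.total hx hy).imp (fun h => h.1) fun h => h.1
    have hC₂ : IsChain (· ≤ ·) (Prod.snd '' C) := by
      rintro _ ⟨x, hx, rfl⟩ _ ⟨y, hy, rfl⟩ _
      exact (hC.total hx hy).imp (fun h => h.2) fun h => h.2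
    have hb₁ : ∀ c ∈ Prod.fst '' C, c ≤ d := by
      rintro _ ⟨x, hx, rfl⟩
      obtain ⟨-, -, w, hw, hwd⟩ := hCT hx
      exact (le_of_add hw).trans hwd
    have hb₂ : ∀ c ∈ Prod.snd '' C, c ≤ d := by
      rintro _ ⟨x, hx, rfl⟩
      obtain ⟨-, -, w, hw, hwd⟩ := hCT hx
      exact (le_of_add' hw).trans hwd
    obtain ⟨s₁, hs₁d, hCs₁, hs₁⟩ := hmea.exists_lub hC₁ hd.meager hb₁
    obtain ⟨s₂, hs₂d, hCs₂, hs₂⟩ := hmea.exists_lub hC₂ hd.meager hb₂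
    -- Mixed sums stay below `d`, so the two coordinates can be replaced by their suprema one after
    -- the other.
    have key : ∀ x ∈ C, ∀ y ∈ C, ∃ w : E, (x.1 : OSum E) + y.2 = w ∧ w ≤ d := by
      intro x hx y hy
      rcases hC.total hx hy with hxy | hxy
      · obtain ⟨-, -, w, hw, hwd⟩ := hCT hy
        obtain ⟨r, hr, hrw⟩ := exists_add_of_le hxy.1 (le_refl y.2) hw
        exact ⟨r, hr, hrw.trans hwd⟩
      · obtain ⟨-, -, w, hw, hwd⟩ := hCT hx
        obtain ⟨r, hr, hrw⟩ := exists_add_of_le (le_refl x.1) hxy.2 hw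
        exact ⟨r, hr, hrw.trans hwd⟩
    have key₂ : ∀ x ∈ C, ∃ w : E, (x.1 : OSum E) + s₂ = w ∧ w ≤ d := by
      intro x hx
      obtain ⟨e, he⟩ := le_iff.1 (hb₁ _ ⟨x, hx, rfl⟩)
      have hle : s₂ ≤ e := by
        refine hs₂ e (hd.meager.mono (le_of_add' he)) ?_
        rintro _ ⟨y, hy, rfl⟩
        obtain ⟨w, hw, hwd⟩ := key x hx y hy
        exact le_of_add_le_add hw he hwd
      exact exists_add_of_le le_rfl hle he
    obtain ⟨e, he⟩ := le_iff.1 hs₂d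
    have hle : s₁ ≤ e := by
      refine hs₁ e (hd.meager.mono (le_of_add' he)) ?_
      rintro _ ⟨x, hx, rfl⟩
      obtain ⟨w, hw, hwd⟩ := key₂ x hx
      rw [add_comm] at hw
      exact le_of_add_le_add hw he hwd
    refine ⟨(s₁, s₂), ⟨?_, ?_, exists_add_of_le hle le_rfl (by rw [add_comm, he])⟩, fun x hx =>
      ⟨hCs₁ _ ⟨x, hx, rfl⟩, hCs₂ _ ⟨x, hx, rfl⟩⟩⟩
    -- `v₁` need not be meager, so `s₁` is compared with its meager part, which bounds all first
    -- coordinates because they are small in `v₁`.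
    · obtain ⟨t, n, htn, -⟩ := hhom.exists_greatest_decomp hsd v₁
      refine (hs₁ n htn.2.1 ?_).trans (le_of_add' (add_eq_coe.2 htn.2.2))
      rintro _ ⟨x, hx, rfl⟩
      exact (hd.mono (hb₁ _ ⟨x, hx, rfl⟩) (le_of_add h) (hCT hx).1).le_meager_part hhom hmea htn
    · obtain ⟨t, n, htn, -⟩ := hhom.exists_greatest_decomp hsd v₂
      refine (hs₂ n htn.2.1 ?_).trans (le_of_add' (add_eq_coe.2 htn.2.2))
      rintro _ ⟨x, hx, rfl⟩
      exact (hd.mono (hb₂ _ ⟨x, hx, rfl⟩) (le_of_add' h) (hCT hx).2.1).le_meager_part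
        hhom hmea htn) _ h0T
  obtain ⟨ha, hb, w, hw, hwd⟩ := hT.prop
  obtain ⟨u, hu⟩ := le_iff.1 hwd
  obtain ⟨a', ha'⟩ := le_iff.1 ha
  obtain ⟨b', hb'⟩ := le_iff.1 hb
  obtain ⟨e, he⟩ := le_iff.1 hd.le
  by_cases hu0 : u = zero
  · refine ⟨a, b, ha, hb, ?_⟩
    rw [hw, ← hu, hu0, coe_zero, add_zero]
  exfalso
  -- Unlike `u`, this `x` is orthogonal to `p`; homogeneity splits it over what is left of `v₁` and
  -- `v₂`, enlarging the maximal pair.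
  obtain ⟨x, hxu, hx0, hxp⟩ := hd.exists_le u (le_of_add' hu) hu0
  dsimp only at *
  have h1 : (w : OSum E) + (a' + b') = p := by
    rw [← h, ← ha', ← hb', ← hw]; abel
  have h2 : (w : OSum E) + (u + e) = p := by
    rw [← add_assoc, hu, he]
  obtain ⟨v, hv⟩ := exists_right h1
  rw [hv] at h1
  have huv : (u : OSum E) + e = v := cancel h2 h1
  have hvp : v ≤ p := le_of_add' h1
  obtain ⟨x₁, x₂, hx₁, hx₂, hx⟩ :=
    hhom.split hv (hxu.trans (le_of_add huv)) (hvp.trans (le_compl_comm hxp))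
  obtain ⟨a₁, ha₁, ha₁v⟩ := exists_add_of_le (le_refl a) hx₁ ha'
  obtain ⟨b₁, hb₁, hb₁v⟩ := exists_add_of_le (le_refl b) hx₂ hb'
  obtain ⟨w₁, hw₁, hw₁d⟩ := exists_add_of_le (le_refl w) hxu hu
  have hmem : ((a₁, b₁) : E × E) ∈ T := by
    refine ⟨ha₁v, hb₁v, w₁, ?_, hw₁d⟩
    dsimp only
    rw [← ha₁, ← hb₁, ← hw₁, ← hw, ← hx]; abel
  have hle := hT.le_of_ge hmem ⟨le_of_add ha₁, le_of_add hb₁⟩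
  have e1 := add_left_eq ha₁ (le_antisymm (le_of_add ha₁) hle.1)
  have e2 := add_left_eq hb₁ (le_antisymm (le_of_add hb₁) hle.2)
  rw [e1, e2, add_zero] at hx
  exact hx0 (of_injective hx).symm

end Small

/-! ### Finite partitions and splitting of meager entries -/

section Multisets

variable {E : Type u}

theorem Multiset.exists_add_of_le_add {α : Type u} {U X Y : Multiset α} (h : U ≤ X + Y) :
    ∃ V W, V ≤ X ∧ W ≤ Y ∧ U = V + W := by
  classical
  refine ⟨U ∩ X, U - X, Multiset.inter_le_right, Multiset.sub_le_iff_le_add'.2 h, ?_⟩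
  rw [add_comm, Multiset.sub_add_inter]

/-- The sum of a finite multiset. -/
def msum [GenEffectAlgebra E] (R : Multiset E) : OSum E := (R.map OSum.of).sum

/-- Each sum of a part of `P` is the sum of a part of `R`. -/
def Covers [GenEffectAlgebra E] (R P : Multiset E) : Prop :=
  ∀ A ≤ P, ∃ A' ≤ R, msum A' = msum A

/-- `R` is a union of multisets with the sums given by the list. -/
def Refines [GenEffectAlgebra E] : Multiset E → List E → Prop
  | R, [] => R = 0
  | R, p :: P => ∃ R₀ R₁, R = R₀ + R₁ ∧ msum R₀ = p ∧ Refines R₁ P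

section Gen

variable [GenEffectAlgebra E]

@[simp] theorem msum_zero : msum (0 : Multiset E) = 0 := rfl

@[simp] theorem msum_cons (a : E) (R : Multiset E) : msum (a ::ₘ R) = a + msum R := by
  simp [msum]

@[simp] theorem msum_add (R S : Multiset E) : msum (R + S) = msum R + msum S := by
  simp [msum]

@[simp] theorem msum_singleton (a : E) : msum {a} = a := by simp [msum]

theorem Covers.refl (R : Multiset E) : Covers R R := fun A hA => ⟨A, hA, rfl⟩

theorem Covers.trans {R S T : Multiset E} (h : Covers R S) (h' : Covers S T) : Covers R T := by
  intro A hA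
  obtain ⟨A', hA', e⟩ := h' A hA
  obtain ⟨A'', hA'', e'⟩ := h A' hA'
  exact ⟨A'', hA'', e'.trans e⟩

theorem Covers.add {R S R' S' : Multiset E} (h : Covers R S) (h' : Covers R' S') :
    Covers (R + R') (S + S') := by
  intro A hA
  obtain ⟨V, W, hV, hW, rfl⟩ := Multiset.exists_add_of_le_add hA
  obtain ⟨V', hV', e⟩ := h V hV
  obtain ⟨W', hW', e'⟩ := h' W hW
  exact ⟨V' + W', add_le_add hV' hW', by rw [msum_add, msum_add, e, e']⟩

theorem Covers.singleton {R : Multiset E} {a : E} (h : msum R = a) : Covers R {a} := by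
  intro A hA
  rcases Multiset.le_singleton.1 hA with rfl | rfl
  · exact ⟨0, Multiset.zero_le _, rfl⟩
  · exact ⟨R, le_rfl, by rw [h, msum_singleton]⟩

theorem Refines.zero_left {P : List E} (h : msum (P : Multiset E) = 0) :
    Refines (0 : Multiset E) P := by
  induction P with
  | nil => rfl
  | cons p P ih =>
    rw [← Multiset.cons_coe, msum_cons] at h
    obtain ⟨b, hb⟩ := exists_right (c := zero) h
    rw [hb] at h
    obtain ⟨h1, h2⟩ := GenEffectAlgebra.pos p b h
    refine ⟨0, 0, (add_zero _).symm, ?_, ih (by rw [hb, h2]; rfl)⟩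
    rw [h1]; rfl

end Gen

variable [EffectAlgebra E]

/-- `R'` arises from `R` by splitting a meager element. -/
def SplitStep (R R' : Multiset E) : Prop :=
  ∃ (t t₁ t₂ : E) (R₀ : Multiset E), IsMeager t ∧ (t₁ : OSum E) + t₂ = t ∧
    R = t ::ₘ R₀ ∧ R' = t₁ ::ₘ t₂ ::ₘ R₀

/-- `R'` arises from `R` by successively splitting meager elements. -/
def MeagerRef (R R' : Multiset E) : Prop := Relation.ReflTransGen SplitStep R R'

/-- All elements are sharp or meager. -/
def SharpOrMeager (R : Multiset E) : Prop := ∀ a ∈ R, IsSharp a ∨ IsMeager a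

theorem SplitStep.add_right {R R' : Multiset E} (h : SplitStep R R') (G : Multiset E) :
    SplitStep (R + G) (R' + G) := by
  obtain ⟨t, t₁, t₂, R₀, ht, hsum, rfl, rfl⟩ := h
  exact ⟨t, t₁, t₂, R₀ + G, ht, hsum, by simp, by simp⟩

theorem SplitStep.msum_eq {R R' : Multiset E} (h : SplitStep R R') : msum R' = msum R := by
  obtain ⟨t, t₁, t₂, R₀, ht, hsum, rfl, rfl⟩ := h
  rw [msum_cons, msum_cons, msum_cons, ← hsum, add_assoc]

theorem SplitStep.sharpOrMeager {R R' : Multiset E} (h : SplitStep R R')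
    (hR : SharpOrMeager R) : SharpOrMeager R' := by
  obtain ⟨t, t₁, t₂, R₀, ht, hsum, rfl, rfl⟩ := h
  intro a ha
  rcases Multiset.mem_cons.1 ha with rfl | ha
  · exact Or.inr (ht.mono (le_of_add hsum))
  rcases Multiset.mem_cons.1 ha with rfl | ha
  · exact Or.inr (ht.mono (le_of_add' hsum))
  · exact hR a (Multiset.mem_cons_of_mem ha)

theorem SplitStep.covers {R R' : Multiset E} (h : SplitStep R R') : Covers R' R := by
  obtain ⟨t, t₁, t₂, R₀, ht, hsum, rfl, rfl⟩ := h
  have h1 : Covers ({t₁, t₂} : Multiset E) {t} :=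
    Covers.singleton (by rw [Multiset.insert_eq_cons, msum_cons, msum_singleton, hsum])
  have := h1.add (Covers.refl R₀)
  simpa using this

theorem SplitStep.exists_of_add {X Y Z : Multiset E} (h : SplitStep (X + Y) Z) :
    ∃ X' Y', Z = X' + Y' ∧ MeagerRef X X' ∧ MeagerRef Y Y' := by
  obtain ⟨t, t₁, t₂, R₀, ht, hsum, hR, rfl⟩ := h
  have hmem : t ∈ X + Y := by rw [hR]; exact Multiset.mem_cons_self _ _
  rcases Multiset.mem_add.1 hmem with hX | hY
  · obtain ⟨X₀, rfl⟩ := Multiset.exists_cons_of_mem hX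
    rw [Multiset.cons_add, Multiset.cons_inj_right] at hR
    refine ⟨t₁ ::ₘ t₂ ::ₘ X₀, Y, by rw [← hR]; simp, .single ⟨t, t₁, t₂, X₀, ht, hsum, rfl, rfl⟩,
      .refl⟩
  · obtain ⟨Y₀, rfl⟩ := Multiset.exists_cons_of_mem hY
    rw [Multiset.add_cons, Multiset.cons_inj_right] at hR
    refine ⟨X, t₁ ::ₘ t₂ ::ₘ Y₀, by rw [← hR]; simp, .refl,
      .single ⟨t, t₁, t₂, Y₀, ht, hsum, rfl, rfl⟩⟩

namespace MeagerRef

theorem refl (R : Multiset E) : MeagerRef R R := Relation.ReflTransGen.refl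

theorem trans {R S T : Multiset E} (h : MeagerRef R S) (h' : MeagerRef S T) : MeagerRef R T :=
  Relation.ReflTransGen.trans h h'

theorem add_right {R R' : Multiset E} (h : MeagerRef R R') (G : Multiset E) :
    MeagerRef (R + G) (R' + G) := by
  induction h with
  | refl => exact refl _
  | tail _ h ih => exact ih.tail (h.add_right G)

theorem add {R R' S S' : Multiset E} (h : MeagerRef R R') (h' : MeagerRef S S') :
    MeagerRef (R + S) (R' + S') := by
  refine (h.add_right S).trans ?_
  rw [add_comm R', add_comm R']
  exact h'.add_right R'

theorem msum_eq {R R' : Multiset E} (h : MeagerRef R R') : msum R' = msum R := by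
  induction h with
  | refl => rfl
  | tail _ h ih => exact h.msum_eq.trans ih

theorem sharpOrMeager {R R' : Multiset E} (h : MeagerRef R R') (hR : SharpOrMeager R) :
    SharpOrMeager R' := by
  induction h with
  | refl => exact hR
  | tail _ h ih => exact h.sharpOrMeager ih

theorem covers {R R' : Multiset E} (h : MeagerRef R R') : Covers R' R := by
  induction h with
  | refl => exact Covers.refl _
  | tail _ h ih => exact h.covers.trans ih

theorem exists_of_add {X Y Z : Multiset E} (h : MeagerRef (X + Y) Z) :
    ∃ X' Y', Z = X' + Y' ∧ MeagerRef X X' ∧ MeagerRef Y Y' := by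
  generalize hW : X + Y = W at h
  induction h with
  | refl => exact ⟨X, Y, hW.symm, refl X, refl Y⟩
  | tail _ h ih =>
    obtain ⟨X', Y', rfl, hX, hY⟩ := ih
    obtain ⟨X'', Y'', rfl, hX', hY'⟩ := h.exists_of_add
    exact ⟨X'', Y'', rfl, hX.trans hX', hY.trans hY'⟩

theorem refines {R R' : Multiset E} {P : List E} (h : MeagerRef R R') (hP : Refines R P) :
    Refines R' P := by
  induction P generalizing R R' with
  | nil =>
    rw [Refines] at hP ⊢
    subst hP
    rcases Relation.ReflTransGen.cases_head h with h | ⟨S, ⟨t, t₁, t₂, R₀, -, -, h0, -⟩, -⟩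
    · exact h.symm
    · exact absurd h0 (Multiset.zero_ne_cons)
  | cons p P ih =>
    obtain ⟨R₀, R₁, rfl, h0, h1⟩ := hP
    obtain ⟨X, Y, rfl, hX, hY⟩ := h.exists_of_add
    exact ⟨X, Y, rfl, hX.msum_eq.trans h0, ih hY h1⟩

end MeagerRef

/-- A small element of the sum becomes a partial sum after splitting meager elements. -/
theorem IsSmall.exists_meagerRef (hhom : Homogeneous E) (hmea : MeagerOrthocomplete E)
    (hsd : SharplyDominating E) {F : Multiset E} (hF : SharpOrMeager F) {d f : E}
    (hf : msum F = f) (hd : IsSmall d f) :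
    ∃ F₁ F₂, MeagerRef F (F₁ + F₂) ∧ msum F₁ = d := by
  induction F using Multiset.induction_on generalizing d f with
  | empty =>
    refine ⟨0, 0, .refl _, ?_⟩
    have : f = zero := (of_injective hf).symm
    have hd0 := hd.le
    rw [this] at hd0
    rw [le_zero hd0]
    rfl
  | cons a F ih =>
    rw [msum_cons] at hf
    obtain ⟨f', hf'⟩ := exists_right hf
    rw [hf'] at hf
    obtain ⟨d₁, d₂, h1, h2, h12⟩ := hd.split hhom hmea hsd hf
    obtain ⟨G₁, G₂, hG, hsum⟩ := ih (fun b hb => hF b (Multiset.mem_cons_of_mem hb)) hf'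
      (hd.mono (le_of_add' h12) (le_of_add' hf) h2)
    rcases hF a (Multiset.mem_cons_self _ _) with ha | ha
    · have hd₁ := (hd.mono (le_of_add h12) (le_of_add hf) h1).eq_zero_of_isSharp ha
      refine ⟨G₁, {a} + G₂, ?_, ?_⟩
      · have := (MeagerRef.refl {a}).add hG
        rwa [Multiset.singleton_add, add_left_comm] at this
      · rw [hsum, ← h12, hd₁, coe_zero, zero_add]
    · obtain ⟨c, hc⟩ := le_iff.1 h1
      refine ⟨{d₁} + G₁, {c} + G₂, ?_, ?_⟩
      · have h3 : MeagerRef ({a} : Multiset E) ({d₁} + {c}) :=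
          .single ⟨a, d₁, c, 0, ha, hc, rfl, rfl⟩
        have := h3.add hG
        rwa [Multiset.singleton_add a, add_add_add_comm] at this
      · rw [msum_add, msum_singleton, hsum, h12]

/-- Each entry of `T` lies below a meager part, hence is small and can be carved out of `R` as a
partial sum. What remains at the end sums to `s`, so sharp entries are never split. -/
theorem EffectAlgebra.IsSharpMeagerDecomp.exists_covers (hhom : Homogeneous E) (hmea : MeagerOrthocomplete E)
    (hsd : SharplyDominating E) {p s m : E} (h : IsSharpMeagerDecomp p s m) {T R : Multiset E}
    (hT : msum T = m) (hR : SharpOrMeager R) (hRp : msum R = p) :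
    ∃ R', MeagerRef R R' ∧ Covers R' (s ::ₘ T) := by
  induction T using Multiset.induction_on generalizing p m R with
  | empty =>
    refine ⟨R, .refl R, Covers.singleton ?_⟩
    have := h.2.2
    rw [← add_eq_coe, ← hT, msum_zero, add_zero] at this
    rw [hRp, this]
  | cons t T ih =>
    rw [msum_cons] at hT
    obtain ⟨m', hm'⟩ := exists_right hT
    rw [hm'] at hT
    obtain ⟨hs, hm, hsm⟩ := isSharpMeagerDecomp_iff.1 h
    obtain ⟨F₁, F₂, hF, hsum⟩ := (hhom.small_of_add hmea hs hm hsm (le_of_add hT)).exists_meagerRef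
      hhom hmea hsd hR hRp
    have h1 : (t : OSum E) + msum F₂ = p := by
      rw [← hsum, ← msum_add, hF.msum_eq, hRp]
    have h2 : (t : OSum E) + (s + m') = p := by
      rw [← hsm, ← hT]; abel
    obtain ⟨p', hp'⟩ := exists_right h2
    have h3 : msum F₂ = p' := by rw [← hp', OSum.cancel h1 h2]
    obtain ⟨F₃, hF₃, hcov⟩ := ih (p := p') (m := m') (R := F₂)
      ⟨hs, hm.mono (le_of_add' hT), hp'⟩ hm'
      (fun a ha => hF.sharpOrMeager hR a (Multiset.mem_add.2 (Or.inr ha))) h3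
    refine ⟨F₁ + F₃, hF.trans ((MeagerRef.refl F₁).add hF₃), ?_⟩
    have := (Covers.singleton hsum).add hcov
    rwa [Multiset.singleton_add, Multiset.cons_swap] at this

end Multisets

/-! ### Common refinements and good partitions -/

section Blocks

variable {E : Type u} [EffectAlgebra E]

namespace SubEffectAlgebra

theorem add_mem (B : SubEffectAlgebra E) {x y z : E} (h : (x : OSum E) + y = z)
    (hx : x ∈ B.carrier) (hy : y ∈ B.carrier) : z ∈ B.carrier :=
  (B.two_of_three x y z h (Or.inl ⟨hx, hy⟩)).2.2

theorem sub_mem (B : SubEffectAlgebra E) {x y z : E} (h : (x : OSum E) + y = z)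
    (hx : x ∈ B.carrier) (hz : z ∈ B.carrier) : y ∈ B.carrier :=
  (B.two_of_three x y z h (Or.inr (Or.inl ⟨hx, hz⟩))).2.1

theorem compl_mem (B : SubEffectAlgebra E) {x : E} (hx : x ∈ B.carrier) :
    compl x ∈ B.carrier :=
  B.sub_mem (coe_add_compl x) hx B.one_mem

theorem Elem.le_iff {B : SubEffectAlgebra E} {x y : B.Elem} : x ≤ y ↔ x.val ≤ y.val := by
  constructor
  · rintro ⟨z, hz⟩
    exact ⟨z.1, restrictSum_eq_some.1 hz⟩
  · rintro ⟨z, hz⟩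
    exact ⟨⟨z, B.sub_mem (add_eq_coe.2 hz) x.2 y.2⟩, restrictSum_eq_some.2 hz⟩

theorem hasRDP_iff {B : SubEffectAlgebra E} : HasRDP B.Elem ↔
    ∀ u ∈ B.carrier, ∀ v₁ ∈ B.carrier, ∀ v₂ ∈ B.carrier, ∀ v : E, (v₁ : OSum E) + v₂ = v →
      u ≤ v → ∃ u₁ ∈ B.carrier, ∃ u₂ ∈ B.carrier, u₁ ≤ v₁ ∧ u₂ ≤ v₂ ∧
        (u₁ : OSum E) + u₂ = u := by
  constructor
  · intro h u hu v₁ hv₁ v₂ hv₂ v hv huv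
    obtain ⟨u₁, u₂, h1, h2, h12⟩ := h ⟨u, hu⟩ ⟨v₁, hv₁⟩ ⟨v₂, hv₂⟩ ⟨v, B.add_mem hv hv₁ hv₂⟩
      (restrictSum_eq_some.2 hv) (Elem.le_iff.2 huv)
    exact ⟨u₁.1, u₁.2, u₂.1, u₂.2, Elem.le_iff.1 h1, Elem.le_iff.1 h2,
      restrictSum_eq_some.1 h12⟩
  · intro h u v₁ v₂ v hv huv
    obtain ⟨u₁, hu₁, u₂, hu₂, h1, h2, h12⟩ := h u.1 u.2 v₁.1 v₁.2 v₂.1 v₂.2 v.1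
      (restrictSum_eq_some.1 hv) (Elem.le_iff.1 huv)
    exact ⟨⟨u₁, hu₁⟩, ⟨u₂, hu₂⟩, Elem.le_iff.2 h1, Elem.le_iff.2 h2,
      restrictSum_eq_some.2 h12⟩

/-- The Riesz property splits `p` along the entries of `P`; `P'` collects what is left of them. The
last clause allows the next entry of a second decomposition to be treated inside `P'`. -/
theorem exists_refines_of_add {B : SubEffectAlgebra E} (hB : HasRDP B.Elem) {P : List E}
    (hP : ∀ a ∈ P, a ∈ B.carrier) {p r w : E} (hp : p ∈ B.carrier)
    (hw : msum (P : Multiset E) = w) (h : (p : OSum E) + r = w) :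
    ∃ (Q : Multiset E) (P' : List E), (∀ a ∈ Q, a ∈ B.carrier) ∧ (∀ a ∈ P', a ∈ B.carrier) ∧
      msum Q = p ∧ msum (P' : Multiset E) = r ∧
      ∀ Q', Refines Q' P' → Refines (Q + Q') P := by
  induction P generalizing p r w with
  | nil =>
    rw [← of_injective (b := w) (a := zero) hw] at h
    obtain ⟨h1, h2⟩ := GenEffectAlgebra.pos p r h
    refine ⟨0, [], by simp, by simp, by rw [h1]; rfl, by rw [h2]; rfl, fun Q' h => ?_⟩
    rw [Refines] at h ⊢
    rw [h, add_zero]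
  | cons v P ih =>
    rw [← Multiset.cons_coe, msum_cons] at hw
    obtain ⟨w', hw'⟩ := exists_right hw
    rw [hw'] at hw
    have hvB : v ∈ B.carrier := hP v (by simp)
    have hPB : ∀ a ∈ P, a ∈ B.carrier := fun a ha => hP a (by simp [ha])
    have hw'B : w' ∈ B.carrier := by
      clear ih hw h hP
      induction P generalizing w' with
      | nil => rw [← of_injective (b := w') (a := zero) hw']; exact B.zero_mem
      | cons b P ih =>
        rw [← Multiset.cons_coe, msum_cons] at hw'
        obtain ⟨w'', hw''⟩ := exists_right hw'
        rw [hw''] at hw'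
        exact B.add_mem hw' (hPB b (by simp)) (ih _ hw'' fun a ha => hPB a (by simp [ha]))
    obtain ⟨p₁, hp₁, p₂, hp₂, h1, h2, h12⟩ :=
      hasRDP_iff.1 hB p hp v hvB w' hw'B w hw (le_of_add h)
    obtain ⟨c, hc⟩ := le_iff.1 h1
    obtain ⟨r', hr'⟩ := le_iff.1 h2
    obtain ⟨Q, P', hQB, hP'B, hQ, hP', href⟩ := ih hPB hp₂ hw' hr'
    refine ⟨p₁ ::ₘ Q, c :: P', ?_, ?_, by rw [msum_cons, hQ, h12], ?_, ?_⟩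
    · intro a ha
      rcases Multiset.mem_cons.1 ha with rfl | ha
      exacts [hp₁, hQB a ha]
    · intro a ha
      rcases List.mem_cons.1 ha with rfl | ha
      exacts [B.sub_mem hc hp₁ hvB, hP'B a ha]
    · rw [← Multiset.cons_coe, msum_cons, hP']
      refine OSum.cancel (p := (p : OSum E)) (c := w) ?_ h
      rw [← hw, ← hc, ← hr', ← h12]; abel
    · rintro _ ⟨X, Y, rfl, hX, hY⟩
      refine ⟨p₁ ::ₘ X, Q + Y, ?_, by rw [msum_cons, hX, hc], href Y hY⟩
      rw [Multiset.cons_add, Multiset.cons_add, add_left_comm]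

/-- Finite decompositions of an element in an algebra with the Riesz decomposition property have
a common refinement. -/
theorem exists_common_refinement {B : SubEffectAlgebra E} (hB : HasRDP B.Elem) {P₁ P₂ : List E}
    (h₁ : ∀ a ∈ P₁, a ∈ B.carrier) (h₂ : ∀ a ∈ P₂, a ∈ B.carrier) {w : E}
    (hw₁ : msum (P₁ : Multiset E) = w) (hw₂ : msum (P₂ : Multiset E) = w) :
    ∃ Q : Multiset E, (∀ a ∈ Q, a ∈ B.carrier) ∧ Refines Q P₁ ∧ Refines Q P₂ := by
  induction P₁ generalizing P₂ w with
  | nil =>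
    refine ⟨0, by simp, rfl, Refines.zero_left ?_⟩
    rw [hw₂, ← hw₁]; rfl
  | cons p P ih =>
    rw [← Multiset.cons_coe, msum_cons] at hw₁
    obtain ⟨w', hw'⟩ := exists_right hw₁
    rw [hw'] at hw₁
    obtain ⟨Q, P', hQB, hP'B, hQ, hP', href⟩ :=
      exists_refines_of_add hB h₂ (h₁ p (by simp)) hw₂ hw₁
    obtain ⟨Q', hQ'B, hQ'₁, hQ'₂⟩ := ih (fun a ha => h₁ a (by simp [ha])) hP'B hw' hP'
    refine ⟨Q + Q', fun a ha => ?_, ⟨Q, Q', rfl, hQ, hQ'₁⟩, href Q' hQ'₂⟩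
    rcases Multiset.mem_add.1 ha with ha | ha
    exacts [hQB a ha, hQ'B a ha]

/-- `R` arises from the list by decomposing each entry into its sharp part and finitely many
meager elements. -/
inductive CellSum (B : SubEffectAlgebra E) : List E → Multiset E → Prop
  | nil : CellSum B [] 0
  | cons {p s m : E} {T : Multiset E} {P : List E} {R : Multiset E} (hp : p ∈ B.carrier)
      (hd : IsSharpMeagerDecomp p s m) (hT : msum T = m) (h : CellSum B P R) :
      CellSum B (p :: P) (s ::ₘ T + R)

namespace CellSum

variable {B : SubEffectAlgebra E} {P : List E} {R : Multiset E}

theorem mem (h : CellSum B P R) : ∀ a ∈ P, a ∈ B.carrier := by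
  induction h with
  | nil => simp
  | cons hp _ _ _ ih =>
    intro a ha
    rcases List.mem_cons.1 ha with rfl | ha
    exacts [hp, ih a ha]

theorem msum_eq (h : CellSum B P R) : msum R = msum (P : Multiset E) := by
  induction h with
  | nil => rfl
  | cons hp hd hT _ ih =>
    rw [← Multiset.cons_coe, msum_cons, msum_add, msum_cons, ih, hT, add_eq_coe.2 hd.2.2]

theorem _root_.EffectAlgebra.IsMeager.of_mem_of_msum {T : Multiset E} {m a : E} (hm : IsMeager m)
    (hT : msum T = m) (ha : a ∈ T) : IsMeager a := by
  obtain ⟨T', rfl⟩ := Multiset.exists_cons_of_mem ha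
  rw [msum_cons] at hT
  exact hm.mono (le_of_add hT)

theorem sharpOrMeager (h : CellSum B P R) : SharpOrMeager R := by
  induction h with
  | nil => intro a ha; simp at ha
  | cons hp hd hT _ ih =>
    intro a ha
    rcases Multiset.mem_add.1 ha with ha | ha
    · rcases Multiset.mem_cons.1 ha with rfl | ha
      · exact Or.inl hd.1
      · exact Or.inr (hd.2.1.of_mem_of_msum hT ha)
    · exact ih a ha

/-- A split entry normally belongs to the meager part of one cell. If it is a sharp part, being also
meager it is zero, and so are both pieces. -/
theorem splitStep (h : CellSum B P R) {R' : Multiset E} (hR : SplitStep R R') :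
    CellSum B P R' := by
  induction h generalizing R' with
  | nil =>
    obtain ⟨t, t₁, t₂, R₀, -, -, h0, -⟩ := hR
    exact absurd h0 Multiset.zero_ne_cons
  | @cons p s m T P R hp hd hT h ih =>
    obtain ⟨t, t₁, t₂, R₀, ht, hsum, h0, rfl⟩ := hR
    have hmem : t ∈ s ::ₘ T + R := by rw [h0]; exact Multiset.mem_cons_self _ _
    rcases Multiset.mem_add.1 hmem with hm | hm
    · rcases Multiset.mem_cons.1 hm with rfl | hm
      · have hz := hd.1.eq_zero_of_isMeager ht
        rw [Multiset.cons_add, Multiset.cons_inj_right] at h0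
        rw [hz] at hsum
        obtain ⟨h1, h2⟩ := GenEffectAlgebra.pos _ _ hsum
        have hT' : msum (zero ::ₘ T) = m := by rw [msum_cons, hT, coe_zero, zero_add]
        have := cons hp hd hT' h
        rw [h1, h2]
        rwa [hz, Multiset.cons_add, Multiset.cons_add, h0] at this
      · obtain ⟨T₀, rfl⟩ := Multiset.exists_cons_of_mem hm
        rw [Multiset.cons_swap, Multiset.cons_add, Multiset.cons_inj_right] at h0
        have hT' : msum (t₁ ::ₘ t₂ ::ₘ T₀) = m := by
          rw [← hT, msum_cons, msum_cons, msum_cons, ← hsum, add_assoc]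
        have := cons hp hd hT' h
        rwa [Multiset.cons_swap, Multiset.cons_swap s, Multiset.cons_add, Multiset.cons_add,
          h0] at this
    · obtain ⟨R₁, rfl⟩ := Multiset.exists_cons_of_mem hm
      rw [Multiset.add_cons, Multiset.cons_inj_right] at h0
      have := cons hp hd hT (ih ⟨t, t₁, t₂, R₁, ht, hsum, rfl, rfl⟩)
      rwa [Multiset.add_cons, Multiset.add_cons, h0] at this

theorem meagerRef (h : CellSum B P R) {R' : Multiset E} (hR : MeagerRef R R') :
    CellSum B P R' := by
  induction hR with
  | refl => exact h
  | tail _ h' ih => exact ih.splitStep h'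

theorem exists_covers (hhom : Homogeneous E) (hmea : MeagerOrthocomplete E)
    (hsd : SharplyDominating E) (h : CellSum B P R) {S : Multiset E} (hS : SharpOrMeager S)
    (hSP : Refines S P) : ∃ S', MeagerRef S S' ∧ Covers S' R := by
  induction h generalizing S with
  | nil => exact ⟨S, .refl S, fun A hA => ⟨0, Multiset.zero_le _, by rw [Multiset.le_zero.1 hA]⟩⟩
  | cons hp hd hT h ih =>
    obtain ⟨S₀, S₁, rfl, h0, h1⟩ := hSP
    obtain ⟨S₀', href, hcov⟩ := hd.exists_covers hhom hmea hsd hT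
      (fun a ha => hS a (Multiset.mem_add.2 (Or.inl ha))) h0
    obtain ⟨S₁', href', hcov'⟩ := ih (fun a ha => hS a (Multiset.mem_add.2 (Or.inr ha))) h1
    exact ⟨S₀' + S₁', href.add href', hcov.add hcov'⟩

end CellSum

theorem exists_cellSum (hhom : Homogeneous E) (hsd : SharplyDominating E)
    (B : SubEffectAlgebra E) {Q : Multiset E} (hQ : ∀ a ∈ Q, a ∈ B.carrier) :
    ∃ (L : List E) (R : Multiset E), (L : Multiset E) = Q ∧ CellSum B L R ∧
      ∀ P, Refines Q P → Refines R P := by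
  choose s m hsm _ using hhom.exists_greatest_decomp hsd
  let f : Multiset E → Multiset E := fun Q => Q.bind fun q => {s q, m q}
  have hfadd : ∀ X Y, f (X + Y) = f X + f Y := fun X Y => Multiset.add_bind _ _ _
  have hfcons : ∀ a X, f (a ::ₘ X) = s a ::ₘ {m a} + f X := fun a X => Multiset.cons_bind _ _ _
  have hfsum : ∀ X, msum (f X) = msum X := by
    intro X
    induction X using Multiset.induction_on with
    | empty => rfl
    | cons a X ih =>
      rw [hfcons, msum_add, msum_cons, msum_cons, msum_singleton, ih, add_eq_coe.2 (hsm a).2.2]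
  have hfref : ∀ P X, Refines X P → Refines (f X) P := by
    intro P
    induction P with
    | nil =>
      intro X hX
      rw [Refines] at hX ⊢
      rw [hX]; rfl
    | cons p P ih =>
      rintro _ ⟨X, Y, rfl, hX, hY⟩
      exact ⟨f X, f Y, hfadd X Y, (hfsum X).trans hX, ih Y hY⟩
  have hcell : ∀ L : List E, (∀ a ∈ L, a ∈ B.carrier) → CellSum B L (f L) := by
    intro L
    induction L with
    | nil => exact fun _ => .nil
    | cons a L ih =>
      intro hL
      rw [← Multiset.cons_coe, hfcons]
      exact .cons (hL a (by simp)) (hsm a) (msum_singleton _) (ih fun b hb => hL b (by simp [hb]))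
  exact ⟨Q.toList, f Q, Multiset.coe_toList Q, by
    have := hcell Q.toList fun a ha => hQ a (Multiset.mem_toList.1 ha)
    rwa [Multiset.coe_toList] at this, fun P => hfref P Q⟩

/-- Partitions of `1` obtained from partitions in `B` by decomposing the entries into sharp and
meager elements, the sharp one being the largest sharp element below the entry. -/
def Good (B : SubEffectAlgebra E) (R : Multiset E) : Prop :=
  (∃ P, CellSum B P R) ∧ msum R = (one : E)

theorem Good.meagerRef {B : SubEffectAlgebra E} {R R' : Multiset E} (h : Good B R)
    (hR : MeagerRef R R') : Good B R' := by
  obtain ⟨⟨P, hP⟩, h1⟩ := h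
  exact ⟨⟨P, hP.meagerRef hR⟩, hR.msum_eq.trans h1⟩

theorem Good.sharpOrMeager {B : SubEffectAlgebra E} {R : Multiset E} (h : Good B R) :
    SharpOrMeager R := by
  obtain ⟨⟨P, hP⟩, -⟩ := h
  exact hP.sharpOrMeager

/-- Refine the two underlying partitions inside `B` and cut the entries into sharp and meager parts.
Splitting meager entries realizes the partial sums of `R₁`; splitting further realizes those of `R₂`
and keeps the earlier ones. -/
theorem Good.exists_covers (hhom : Homogeneous E) (hmea : MeagerOrthocomplete E)
    (hsd : SharplyDominating E) {B : SubEffectAlgebra E} (hB : HasRDP B.Elem)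
    {R₁ R₂ : Multiset E} (h₁ : Good B R₁) (h₂ : Good B R₂) :
    ∃ R, Good B R ∧ Covers R R₁ ∧ Covers R R₂ := by
  obtain ⟨⟨P₁, hP₁⟩, hs₁⟩ := h₁
  obtain ⟨⟨P₂, hP₂⟩, hs₂⟩ := h₂
  obtain ⟨Q, hQB, hQ₁, hQ₂⟩ := exists_common_refinement hB hP₁.mem hP₂.mem
    (hP₁.msum_eq.symm.trans hs₁) (hP₂.msum_eq.symm.trans hs₂)
  obtain ⟨L, R, rfl, hR, href⟩ := exists_cellSum hhom hsd B hQB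
  obtain ⟨R', hR', hcov⟩ := hP₁.exists_covers hhom hmea hsd hR.sharpOrMeager (href _ hQ₁)
  obtain ⟨R'', hR'', hcov'⟩ := hP₂.exists_covers hhom hmea hsd (hR'.sharpOrMeager hR.sharpOrMeager)
    (hR'.refines (href _ hQ₂))
  refine ⟨R'', ⟨⟨L, (hR.meagerRef hR').meagerRef hR''⟩, ?_⟩, hR''.covers.trans hcov, hcov'⟩
  rw [hR''.msum_eq, hR'.msum_eq, ← hs₁]
  have hRP : ∀ (S : Multiset E) (P : List E), Refines S P → msum S = msum (P : Multiset E) := by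
    intro S P
    induction P generalizing S with
    | nil =>
      intro h
      rw [Refines] at h
      rw [h]; rfl
    | cons p P ih =>
      rintro ⟨X, Y, rfl, hX, hY⟩
      rw [msum_add, hX, ih Y hY, ← Multiset.cons_coe, msum_cons]
  rw [hRP _ _ (href _ hQ₁), hP₁.msum_eq]

end SubEffectAlgebra

end Blocks

/-! ### The sub-effect algebra generated by good partitions -/

section Span

variable {E : Type u} [EffectAlgebra E]

namespace SubEffectAlgebra

/-- Orthogonal partial sums can be made disjoint. -/
theorem Good.exists_disjoint (hhom : Homogeneous E) (hmea : MeagerOrthocomplete E)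
    (hsd : SharplyDominating E) {B : SubEffectAlgebra E} {R A C : Multiset E} (hR : Good B R)
    (hA : A ≤ R) (hC : C ≤ R) {x z w : E} (hx : msum A = x) (hz : msum C = z)
    (hw : (x : OSum E) + z = w) :
    ∃ A' C' G, Good B (A' + C' + G) ∧ Covers (A' + C' + G) R ∧ msum A' = x ∧ msum C' = z := by
  classical
  obtain ⟨G, hG⟩ := Multiset.le_iff_exists_add.1 (Multiset.union_le hA hC)
  have hA' : A = (A - C) + C ∩ A := by rw [Multiset.inter_comm, Multiset.sub_add_inter]
  have hC' : C = (C - A) + C ∩ A := (Multiset.sub_add_inter C A).symm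
  have hU : A ∪ C = (A - C) + C := rfl
  generalize A - C = A₀ at *
  generalize C - A = C₀ at *
  generalize C ∩ A = D at *
  rw [hU] at hG
  subst hA' hC'
  have hsum := hR.2
  subst hG
  simp only [msum_add] at hsum hx hz
  obtain ⟨d, hd⟩ := exists_right hx
  have hk := coe_add_compl w
  -- The overlap `D` is counted twice in `x ⊕ z`, so its sum `d` fits into the sum `g` of the rest
  -- `G`, and `g ⊕ d` is defined. Hence `G` yields a second copy of `d`.
  have e1 : (msum A₀ + msum C₀ + msum D) + (msum D + compl w) = (one : E) := by
    rw [← hk, ← hw, ← hx, ← hz]; abel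
  have e2 : (msum A₀ + msum C₀ + msum D) + msum G = (one : E) := by
    rw [← hsum]; abel
  have hgd := OSum.cancel e1 e2
  obtain ⟨g, hg⟩ := exists_right e2
  rw [hg, hd] at hgd
  have e3 : (msum A₀ + msum C₀) + ((g : OSum E) + d) = (one : E) := by
    rw [← e2, hg, hd]; abel
  obtain ⟨c, hc⟩ := exists_right e3
  have hGR : SharpOrMeager G := fun a ha =>
    hR.sharpOrMeager a (Multiset.mem_add.2 (Or.inr ha))
  obtain ⟨G₁, G₂, hG, hG₁⟩ := (IsSmall.of_le_of_le_compl (le_of_add hgd)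
    (le_compl_of_add hc)).exists_meagerRef hhom hmea hsd hGR hg
  have href : MeagerRef (A₀ + (C₀ + D) + G) ((A₀ + D) + (G₁ + C₀) + G₂) := by
    have := (MeagerRef.refl (A₀ + (C₀ + D))).add hG
    have e : A₀ + (C₀ + D) + (G₁ + G₂) = (A₀ + D) + (G₁ + C₀) + G₂ := by abel
    rwa [e] at this
  refine ⟨A₀ + D, G₁ + C₀, G₂, hR.meagerRef href, href.covers, by rw [msum_add, hx], ?_⟩
  rw [msum_add, hG₁, ← hz, hd, add_comm]

/-- The partial sums of the good partitions. -/
def spanSet (B : SubEffectAlgebra E) : Set E :=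
  {x | ∃ R, Good B R ∧ ∃ A ≤ R, msum A = x}

theorem compl_mem_spanSet {B : SubEffectAlgebra E} {x : E} (hx : x ∈ spanSet B) :
    compl x ∈ spanSet B := by
  obtain ⟨R, hR, A, hA, hx⟩ := hx
  obtain ⟨C, rfl⟩ := Multiset.le_iff_exists_add.1 hA
  refine ⟨A + C, hR, C, Multiset.le_add_left _ _, ?_⟩
  have h := hR.2
  rw [msum_add, hx] at h
  exact OSum.cancel h (coe_add_compl x)

theorem add_mem_spanSet (hhom : Homogeneous E) (hmea : MeagerOrthocomplete E)
    (hsd : SharplyDominating E) {B : SubEffectAlgebra E} (hB : HasRDP B.Elem) {x z w : E}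
    (hx : x ∈ spanSet B) (hz : z ∈ spanSet B) (hw : (x : OSum E) + z = w) : w ∈ spanSet B := by
  obtain ⟨R₁, hR₁, A₁, hA₁, hx⟩ := hx
  obtain ⟨R₂, hR₂, A₂, hA₂, hz⟩ := hz
  obtain ⟨R, hR, hc₁, hc₂⟩ := hR₁.exists_covers hhom hmea hsd hB hR₂
  obtain ⟨A, hA, hAx⟩ := hc₁ A₁ hA₁
  obtain ⟨C, hC, hCz⟩ := hc₂ A₂ hA₂
  obtain ⟨A', C', G, hR', -, hx', hz'⟩ :=
    hR.exists_disjoint hhom hmea hsd hA hC (hAx.trans hx) (hCz.trans hz) hw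
  exact ⟨_, hR', A' + C', Multiset.le_add_right _ _, by rw [msum_add, hx', hz', hw]⟩

theorem sub_mem_spanSet (hhom : Homogeneous E) (hmea : MeagerOrthocomplete E)
    (hsd : SharplyDominating E) {B : SubEffectAlgebra E} (hB : HasRDP B.Elem) {x z w : E}
    (hx : x ∈ spanSet B) (hz : w ∈ spanSet B) (hw : (x : OSum E) + z = w) : z ∈ spanSet B := by
  have h : (x : OSum E) + compl w = (↑(compl z) : OSum E) := by
    rw [add_comm] at hw
    rw [coe_compl_of_add hw, add_comm]
  have := compl_mem_spanSet
    (add_mem_spanSet hhom hmea hsd hB hx (compl_mem_spanSet hz) h)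
  rwa [compl_invol] at this

/-- The witness cuts `y` into `s`, `t` and the rest of `m`, and `y'` into its sharp and meager
parts. -/
theorem subset_spanSet (hhom : Homogeneous E) (hsd : SharplyDominating E)
    {B : SubEffectAlgebra E} {y s m t : E} (hy : y ∈ B.carrier)
    (h : IsSharpMeagerDecomp y s m) (ht : t ≤ m) :
    y ∈ spanSet B ∧ s ∈ spanSet B ∧ t ∈ spanSet B := by
  obtain ⟨s', m', h', -⟩ := hhom.exists_greatest_decomp hsd (compl y)
  obtain ⟨r, hr⟩ := le_iff.1 ht
  have hT : msum ({t, r} : Multiset E) = m := by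
    rw [Multiset.insert_eq_cons, msum_cons, msum_singleton, hr]
  have hc := CellSum.cons hy h hT (.cons (B.compl_mem hy) h' (msum_singleton m') .nil)
  have hs := add_eq_coe.2 h.2.2
  have hg : Good B (s ::ₘ {t, r} + (s' ::ₘ {m'} + 0)) := by
    refine ⟨⟨_, hc⟩, ?_⟩
    rw [hc.msum_eq, ← coe_add_compl y]
    simp [← Multiset.cons_coe]
  refine ⟨⟨_, hg, s ::ₘ {t, r}, Multiset.le_add_right _ _, by rw [msum_cons, hT, hs]⟩,
    ⟨_, hg, {s}, ?_, msum_singleton s⟩, ⟨_, hg, {t}, ?_, msum_singleton t⟩⟩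
  · simp
  · simp

/-- The partial sums of the good partitions form a sub-effect algebra. -/
def span (hhom : Homogeneous E) (hmea : MeagerOrthocomplete E) (hsd : SharplyDominating E)
    (B : SubEffectAlgebra E) (hB : HasRDP B.Elem) : SubEffectAlgebra E where
  carrier := spanSet B
  one_mem := by
    obtain ⟨s, m, h, -⟩ := hhom.exists_greatest_decomp hsd (one : E)
    exact (subset_spanSet hhom hsd B.one_mem h (le_refl m)).1
  two_of_three x y z h := by
    have h' : (y : OSum E) + x = z := by rw [add_comm]; exact h
    rintro (⟨hx, hy⟩ | ⟨hx, hz⟩ | ⟨hy, hz⟩)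
    · exact ⟨hx, hy, add_mem_spanSet hhom hmea hsd hB hx hy h⟩
    · exact ⟨hx, sub_mem_spanSet hhom hmea hsd hB hx hz h, hz⟩
    · exact ⟨sub_mem_spanSet hhom hmea hsd hB hy hz h', hy, hz⟩

/-- Represent `v₁` and `v₂` by disjoint parts of a partition that also represents `u`. The part `g`
of `u` outside them fits into the part `f` of `v` not used by `u`, and `f ⊕ g` is defined;
homogeneity splits `g`, and its summands are small, hence partial sums after further splitting. -/
theorem hasRDP_span (hhom : Homogeneous E) (hmea : MeagerOrthocomplete E)
    (hsd : SharplyDominating E) {B : SubEffectAlgebra E} (hB : HasRDP B.Elem) :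
    HasRDP (span hhom hmea hsd B hB).Elem := by
  rw [hasRDP_iff]
  rintro u ⟨R₀, hR₀, U₀, hU₀, hu₀⟩ v₁ ⟨R₁, hR₁, V₁, hV₁, hv₁⟩ v₂ ⟨R₂, hR₂, V₂, hV₂, hv₂⟩ v hv huv
  obtain ⟨R₃, hR₃, hc₁, hc₂⟩ := hR₁.exists_covers hhom hmea hsd hB hR₂
  obtain ⟨R₄, hR₄, hc₃, hc₀⟩ := hR₃.exists_covers hhom hmea hsd hB hR₀
  obtain ⟨A₁, hA₁, hA₁v⟩ := hc₃.trans hc₁ V₁ hV₁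
  obtain ⟨A₂, hA₂, hA₂v⟩ := hc₃.trans hc₂ V₂ hV₂
  obtain ⟨A, C, G, hR, hcov, hA, hC⟩ := hR₄.exists_disjoint hhom hmea hsd hA₁ hA₂
    (hA₁v.trans hv₁) (hA₂v.trans hv₂) hv
  obtain ⟨U, hU, hUu⟩ := hcov.trans hc₀ U₀ hU₀
  rw [hu₀] at hUu
  obtain ⟨U', UG, hU', hUG, rfl⟩ := Multiset.exists_add_of_le_add hU
  obtain ⟨UA, UC, hUA, hUC, rfl⟩ := Multiset.exists_add_of_le_add hU'
  obtain ⟨FA, rfl⟩ := Multiset.le_iff_exists_add.1 hUA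
  obtain ⟨FC, rfl⟩ := Multiset.le_iff_exists_add.1 hUC
  obtain ⟨FG, rfl⟩ := Multiset.le_iff_exists_add.1 hUG
  have hsm := hR.sharpOrMeager
  have hone := hR.2
  simp only [msum_add] at hone hA hC hUu
  obtain ⟨e, he⟩ := le_iff.1 huv
  have h1 : (msum UA + msum UC) + (msum UG + e) = v := by rw [← he, ← hUu]; abel
  have h2 : (msum UA + msum UC) + (msum FA + msum FC) = v := by
    rw [← hv, ← hA, ← hC]; abel
  have h3 := OSum.cancel h1 h2
  obtain ⟨f, hf⟩ := exists_right h2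
  obtain ⟨g, hg⟩ := exists_right hUu
  obtain ⟨fA, fC, hfA, hfC⟩ := exists_of_add hf
  rw [hfA, hfC] at hf
  rw [hg, hfA, hfC, hf] at h3
  have h4 : (msum UA + msum UC + msum FG) + ((f : OSum E) + g) = (one : E) := by
    rw [← hone, ← hf, ← hfA, ← hfC, ← hg]; abel
  obtain ⟨c, hc⟩ := exists_right h4
  have hfg := le_compl_of_add hc
  obtain ⟨a, b, ha, hb, hab⟩ := hhom.split hf (le_of_add h3) hfg
  have hsa : IsSmall a fA := .of_le_of_le_compl ha
    (((le_of_add hf).trans hfg).trans (compl_le_compl (le_of_add hab)))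
  have hsb : IsSmall b fC := .of_le_of_le_compl hb
    (((le_of_add' hf).trans hfg).trans (compl_le_compl (le_of_add' hab)))
  obtain ⟨X₁, X₂, hX, hX₁⟩ := hsa.exists_meagerRef hhom hmea hsd
    (fun x hx => hsm x (by simp [hx])) hfA
  obtain ⟨Y₁, Y₂, hY, hY₁⟩ := hsb.exists_meagerRef hhom hmea hsd
    (fun x hx => hsm x (by simp [hx])) hfC
  have hgood := hR.meagerRef
    (((((MeagerRef.refl UA).add hX).add ((MeagerRef.refl UC).add hY)).add (.refl (UG + FG))))
  rw [hfA] at hA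
  rw [hfC] at hC
  obtain ⟨ua, hua⟩ := exists_left hA
  obtain ⟨uc, huc⟩ := exists_left hC
  rw [hua] at hA
  rw [huc] at hC
  obtain ⟨u₁, hu₁, hu₁v⟩ := exists_add_of_le (le_refl ua) ha hA
  obtain ⟨u₂, hu₂, hu₂v⟩ := exists_add_of_le (le_refl uc) hb hC
  refine ⟨u₁, ⟨_, hgood, UA + X₁, ?_, by rw [msum_add, hua, hX₁, hu₁]⟩,
    u₂, ⟨_, hgood, UC + Y₁, ?_, by rw [msum_add, huc, hY₁, hu₂]⟩, hu₁v, hu₂v, ?_⟩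
  · exact Multiset.le_iff_exists_add.2 ⟨X₂ + (UC + (Y₁ + Y₂)) + (UG + FG), by abel⟩
  · exact Multiset.le_iff_exists_add.2 ⟨Y₂ + (UA + (X₁ + X₂)) + (UG + FG), by abel⟩
  · rw [← hUu, ← hu₁, ← hu₂, hg, hua, huc, ← hab]; abel

/-- A block contains the parts of its elements and everything below their meager parts. -/
theorem IsBlock.mem_of_decomp (hhom : Homogeneous E) (hmea : MeagerOrthocomplete E)
    (hsd : SharplyDominating E) {B : SubEffectAlgebra E} (hB : B.IsBlock) {y s m t : E}
    (hy : y ∈ B.carrier) (h : IsSharpMeagerDecomp y s m) (ht : t ≤ m) :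
    s ∈ B.carrier ∧ t ∈ B.carrier := by
  have hle : B ≤ span hhom hmea hsd B hB.1 := by
    intro x hx
    obtain ⟨s', m', h', -⟩ := hhom.exists_greatest_decomp hsd x
    exact (subset_spanSet hhom hsd hx h' (le_refl m')).1
  have hsub : spanSet B ⊆ B.carrier := hB.2 (hasRDP_span hhom hmea hsd hB.1) hle
  obtain ⟨-, hs, ht⟩ := subset_spanSet hhom hsd hy h ht
  exact ⟨hsub hs, hsub ht⟩

end SubEffectAlgebra

end Span

/-! ### Meets and joins in a block -/

section Lattice

variable {E : Type u} [EffectAlgebra E]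

namespace SubEffectAlgebra

variable {B : SubEffectAlgebra E}

theorem Elem.isGLB_iff {y z m : B.Elem} : IsGLB {y, z} m ↔ m.val ≤ y.val ∧ m.val ≤ z.val ∧
    ∀ r ∈ B.carrier, r ≤ y.val → r ≤ z.val → r ≤ m.val := by
  constructor
  · intro h
    refine ⟨Elem.le_iff.1 (h.1 (by simp)), Elem.le_iff.1 (h.1 (by simp)), fun r hr hry hrz => ?_⟩
    let r' : B.Elem := ⟨r, hr⟩
    have hrm : r' ≤ m := h.2 (by
      rintro _ (rfl | rfl)
      exacts [Elem.le_iff.2 hry, Elem.le_iff.2 hrz])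
    exact Elem.le_iff.1 hrm
  · rintro ⟨h1, h2, h⟩
    refine ⟨?_, fun r hr => Elem.le_iff.2 (h r.1 r.2 (Elem.le_iff.1 (hr (by simp)))
      (Elem.le_iff.1 (hr (by simp))))⟩
    rintro _ (rfl | rfl)
    exacts [Elem.le_iff.2 h1, Elem.le_iff.2 h2]

/-- Riesz interpolation. -/
theorem exists_between (hB : HasRDP B.Elem) {r t y z : E} (hr : r ∈ B.carrier)
    (ht : t ∈ B.carrier) (hy : y ∈ B.carrier) (hz : z ∈ B.carrier) (hry : r ≤ y) (hrz : r ≤ z)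
    (hty : t ≤ y) (htz : t ≤ z) : ∃ c, r ≤ c ∧ t ≤ c ∧ c ≤ y ∧ c ≤ z := by
  rw [hasRDP_iff] at hB
  obtain ⟨α, hα⟩ := le_iff.1 hty
  obtain ⟨γ, hγ⟩ := le_iff.1 htz
  obtain ⟨a, ha, c, hc, hat, hcα, hac⟩ := hB r hr t ht α (B.sub_mem hα ht hy) y hα hry
  obtain ⟨b, hb⟩ := le_iff.1 hat
  obtain ⟨d, hd⟩ := le_iff.1 hcα
  obtain ⟨e, he⟩ := le_iff.1 hrz
  have h1 : (a : OSum E) + (b + γ) = z := by rw [← add_assoc, hb, hγ]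
  have h2 : (a : OSum E) + (c + e) = z := by rw [← add_assoc, hac, he]
  obtain ⟨f, hf⟩ := exists_right h1
  rw [hf] at h1
  have hce : (c : OSum E) + e = f := OSum.cancel h2 h1
  -- With `r = a ⊕ b₁ ⊕ g` and `a ⊕ b₁ ≤ t`, the interpolant is `t ⊕ g`.
  obtain ⟨b₁, -, g, -, hb₁, hg, hbg⟩ := hB c hc b (B.sub_mem hb ha ht) γ (B.sub_mem hγ ht hz) f hf
    (le_of_add hce)
  obtain ⟨b₂, hb₂⟩ := le_iff.1 hb₁
  obtain ⟨x, hx, hxz⟩ := exists_add_of_le (le_refl t) hg hγ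
  have hgc : g ≤ c := le_of_add' hbg
  refine ⟨x, le_of_add (p := (b₂ : OSum E)) ?_, le_of_add hx, ?_, hxz⟩
  · rw [← hac, ← hbg, ← hx, ← hb, ← hb₂]; abel
  · obtain ⟨w, hw, hwy⟩ := exists_add_of_le (le_refl t) (hgc.trans hcα) hα
    rw [hx] at hw
    rwa [of_injective hw]

/-- Maximal lower bounds are meets. -/
theorem exists_meet_of_isMeager (hmea : MeagerOrthocomplete E) (hB : HasRDP B.Elem) {y z : E}
    (hy : y ∈ B.carrier) (hz : z ∈ B.carrier) (hym : IsMeager y) (hzm : IsMeager z)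
    (hyB : ∀ t, t ≤ y → t ∈ B.carrier) :
    ∃ m ∈ B.carrier, m ≤ y ∧ m ≤ z ∧ ∀ r ∈ B.carrier, r ≤ y → r ≤ z → r ≤ m := by
  let T : Set E := {t | t ≤ y ∧ t ≤ z}
  obtain ⟨t, -, ht⟩ := zorn_le_nonempty₀ T (by
    intro C hCT hC _ _
    obtain ⟨x, hxy, hCx, hx⟩ := hmea.exists_lub hC hym fun c hc => (hCT hc).1
    exact ⟨x, ⟨hxy, hx z hzm fun c hc => (hCT hc).2⟩, hCx⟩) zero ⟨zero_le _, zero_le _⟩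
  obtain ⟨hty, htz⟩ := ht.prop
  -- Zorn's lemma was applied in `E`; interpolation needs the maximal bound to lie in `B`.
  have htB := hyB t hty
  refine ⟨t, htB, hty, htz, fun r hr hry hrz => ?_⟩
  obtain ⟨c, hrc, htc, hcy, hcz⟩ := exists_between hB hr htB hy hz hry hrz hty htz
  exact hrc.trans (ht.le_of_ge (y := c) ⟨hcy, hcz⟩ htc)

/-- Split `y` along `s ⊕ s' = 1`. An `r` below `s` and `y` has no part below `b ≤ s'`, since `s` is
sharp, so `a` is the meet of `s` and `y`. -/
theorem exists_split_of_isSharp (hB : HasRDP B.Elem) {s y : E} (hs : IsSharp s)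
    (hsB : s ∈ B.carrier) (hy : y ∈ B.carrier) :
    ∃ a ∈ B.carrier, ∃ b ∈ B.carrier, a ≤ s ∧ b ≤ compl s ∧ (a : OSum E) + b = y ∧
      ∀ r ∈ B.carrier, r ≤ s → r ≤ y → r ≤ a := by
  rw [hasRDP_iff] at hB
  obtain ⟨a, ha, b, hb, has, hbs, hab⟩ :=
    hB y hy s hsB (compl s) (B.compl_mem hsB) one (coe_add_compl s) (le_one y)
  refine ⟨a, ha, b, hb, has, hbs, hab, fun r hr hrs hry => ?_⟩
  obtain ⟨r₁, -, r₂, -, h1, h2, h12⟩ := hB r hr a ha b hb y hab hry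
  have h0 : r₂ = zero :=
    isSharp_iff.1 hs r₂ ((le_of_add' h12).trans hrs) (h2.trans hbs)
  rw [h0, coe_zero, add_zero] at h12
  rwa [← of_injective h12]

/-- When `v` is split along `s` and `s'`, `p` lies below the first summand and `q` below the second.
-/
theorem exists_add_le_of_isSharp (hB : HasRDP B.Elem) {s p q v : E} (hs : IsSharp s)
    (hsB : s ∈ B.carrier) (hp : p ∈ B.carrier) (hq : q ∈ B.carrier) (hv : v ∈ B.carrier)
    (hps : p ≤ s) (hqs : q ≤ compl s) (hpv : p ≤ v) (hqv : q ≤ v) :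
    ∃ w : E, (p : OSum E) + q = w ∧ w ≤ v := by
  obtain ⟨a, ha, b, hb, has, hbs, hab, hmax⟩ := exists_split_of_isSharp hB hs hsB hv
  obtain ⟨q₁, -, q₂, -, h1, h2, h12⟩ := hasRDP_iff.1 hB q hq a ha b hb v hab hqv
  have h0 : q₁ = zero :=
    isSharp_iff.1 hs q₁ (h1.trans has) ((le_of_add h12).trans hqs)
  rw [h0, coe_zero, zero_add] at h12
  rw [of_injective h12] at h2
  exact exists_add_of_le (hmax p hp hps hpv) h2 hab

/-- The meet of two elements is the sum of the meets of their sharp and meager parts. -/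
theorem isMeet_add (hB : HasRDP B.Elem) {y z yS yM zS zM a b c d : E}
    (hyS : yS ∈ B.carrier) (hyM : yM ∈ B.carrier) (hzS : zS ∈ B.carrier) (hzM : zM ∈ B.carrier)
    (hy : IsSharpMeagerDecomp y yS yM) (hz : IsSharpMeagerDecomp z zS zM)
    (ha : a ∈ B.carrier) (hb : b ∈ B.carrier) (hc : c ∈ B.carrier) (hd : d ∈ B.carrier)
    (ha₁ : a ≤ yS) (ha₂ : a ≤ zS) (ha₃ : ∀ r ∈ B.carrier, r ≤ yS → r ≤ zS → r ≤ a)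
    (hb₁ : b ≤ yS) (hb₂ : b ≤ zM) (hb₃ : ∀ r ∈ B.carrier, r ≤ yS → r ≤ zM → r ≤ b)
    (hc₁ : c ≤ zS) (hc₂ : c ≤ yM) (hc₃ : ∀ r ∈ B.carrier, r ≤ zS → r ≤ yM → r ≤ c)
    (hd₁ : d ≤ yM) (hd₂ : d ≤ zM) (hd₃ : ∀ r ∈ B.carrier, r ≤ yM → r ≤ zM → r ≤ d) :
    ∃ ab ∈ B.carrier, ∃ abc ∈ B.carrier, ∃ m ∈ B.carrier, (a : OSum E) + b = ab ∧
      (ab : OSum E) + c = abc ∧ (abc : OSum E) + d = m ∧ m ≤ y ∧ m ≤ z ∧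
      ∀ r ∈ B.carrier, r ≤ y → r ≤ z → r ≤ m := by
  obtain ⟨hySs, -, hysum⟩ := isSharpMeagerDecomp_iff.1 hy
  obtain ⟨hzSs, -, hzsum⟩ := isSharpMeagerDecomp_iff.1 hz
  have hyMS : yM ≤ compl yS := le_compl_comm (le_compl_of_add hysum)
  have hzMS : zM ≤ compl zS := le_compl_comm (le_compl_of_add hzsum)
  obtain ⟨ab, hab, habS⟩ := exists_add_le_of_isSharp hB hzSs hzS ha hb hyS ha₂
    (hb₂.trans hzMS) ha₁ hb₁
  obtain ⟨cd, hcd, hcdM⟩ := exists_add_le_of_isSharp hB hzSs hzS hc hd hyM hc₁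
    (hd₂.trans hzMS) hc₂ hd₁
  obtain ⟨ac, hac, hacS⟩ := exists_add_le_of_isSharp hB hySs hyS ha hc hzS ha₁
    (hc₂.trans hyMS) ha₂ hc₁
  obtain ⟨bd, hbd, hbdM⟩ := exists_add_le_of_isSharp hB hySs hyS hb hd hzM hb₁
    (hd₁.trans hyMS) hb₂ hd₂
  obtain ⟨m, hm, hmy⟩ := exists_add_of_le habS hcdM hysum
  obtain ⟨m', hm', hmz⟩ := exists_add_of_le hacS hbdM hzsum
  -- The same four meets, grouped once to lie below `y` and once to lie below `z`.
  have hmm : m = m' := by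
    refine of_injective ?_
    rw [← hm, ← hm', ← hab, ← hcd, ← hac, ← hbd]; abel
  have h1 : ((ab : OSum E) + c) + d = m := by rw [← hm, ← hcd, add_assoc]
  obtain ⟨abc, habc⟩ := exists_left h1
  rw [habc] at h1
  have habB := B.add_mem hab ha hb
  have habcB := B.add_mem habc habB hc
  refine ⟨ab, habB, abc, habcB, m, B.add_mem h1 habcB hd, hab, habc, h1, hmy, hmm ▸ hmz,
    fun r hr hry hrz => ?_⟩
  have hB' := hasRDP_iff.1 hB
  -- Splitting `r` along `y` and both parts along `z` gives four pieces, one below each meet.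
  obtain ⟨r₁, hr₁, r₂, hr₂, h1y, h2y, h12⟩ := hB' r hr yS hyS yM hyM y hysum hry
  obtain ⟨r₁₁, hr₁₁, r₁₂, hr₁₂, h11, h12', h1s⟩ :=
    hB' r₁ hr₁ zS hzS zM hzM z hzsum ((le_of_add h12).trans hrz)
  obtain ⟨r₂₁, hr₂₁, r₂₂, hr₂₂, h21, h22, h2s⟩ :=
    hB' r₂ hr₂ zS hzS zM hzM z hzsum ((le_of_add' h12).trans hrz)
  obtain ⟨w₁, hw₁, hw₁le⟩ := exists_add_of_le (ha₃ r₁₁ hr₁₁ ((le_of_add h1s).trans h1y) h11)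
    (hb₃ r₁₂ hr₁₂ ((le_of_add' h1s).trans h1y) h12') hab
  obtain ⟨w₂, hw₂, hw₂le⟩ := exists_add_of_le (hc₃ r₂₁ hr₂₁ h21 ((le_of_add h2s).trans h2y))
    (hd₃ r₂₂ hr₂₂ ((le_of_add' h2s).trans h2y) h22) hcd
  rw [h1s] at hw₁
  rw [h2s] at hw₂
  rw [← of_injective hw₁] at hw₁le
  rw [← of_injective hw₂] at hw₂le
  obtain ⟨w, hw, hwm⟩ := exists_add_of_le hw₁le hw₂le hm
  rw [h12] at hw
  rwa [of_injective hw]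

theorem isLatticeOrder_of_exists_isGLB (h : ∀ y z : B.Elem, ∃ m, IsGLB {y, z} m) :
    IsLatticeOrder B.Elem := by
  intro y z
  refine ⟨h y z, ?_⟩
  obtain ⟨m, hm⟩ := h (compl y) (compl z)
  refine ⟨compl m, ?_, fun w hw => ?_⟩
  · rintro x (rfl | rfl)
    · exact le_compl_comm (hm.1 (by simp))
    · exact le_compl_comm (hm.1 (by simp))
  · have hle : compl w ≤ m := hm.2 (by
      rintro _ (rfl | rfl)
      · exact compl_le_compl (hw (by simp))
      · exact compl_le_compl (hw (by simp)))
    have := compl_le_compl hle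
    rwa [compl_invol] at this

end SubEffectAlgebra

end Lattice

/-- Meets and sums in the last part are taken in the effect algebra `B`. -/
theorem theorem3p16 {E : Type u} [EffectAlgebra E] (hhom : Homogeneous E)
    (hmea : MeagerOrthocomplete E) (hsd : SharplyDominating E)
    (B : SubEffectAlgebra E) (hB : B.IsBlock) :
    IsLatticeOrder B.Elem ∧
    (∀ y : B.Elem, ∃ yS yM : B.Elem, IsSharpMeagerDecomp y.val yS.val yM.val ∧
      ∀ s m : E, IsSharpMeagerDecomp y.val s m → s = yS.val ∧ m = yM.val) ∧
    (∀ y z yS yM zS zM : B.Elem,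
      IsSharpMeagerDecomp y.val yS.val yM.val → IsSharpMeagerDecomp z.val zS.val zM.val →
      ∃ a b c d ab abc m : B.Elem,
        IsGLB {yS, zS} a ∧ IsGLB {yS, zM} b ∧ IsGLB {zS, yM} c ∧ IsGLB {yM, zM} d ∧
        PartialSum.oplus a b = some ab ∧ PartialSum.oplus ab c = some abc ∧
        PartialSum.oplus abc d = some m ∧ IsGLB {y, z} m) := by
  have hdec : ∀ y : B.Elem, ∃ yS yM : B.Elem, IsSharpMeagerDecomp y.val yS.val yM.val ∧
      ∀ s m : E, IsSharpMeagerDecomp y.val s m → s = yS.val ∧ m = yM.val := by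
    intro y
    obtain ⟨s, m, h, -⟩ := hhom.exists_greatest_decomp hsd y.val
    obtain ⟨hs, hm⟩ := hB.mem_of_decomp hhom hmea hsd y.2 h le_rfl
    exact ⟨⟨s, hs⟩, ⟨m, hm⟩, h, fun s' m' h' => hhom.decomp_unique hsd h' h⟩
  have hmeet : ∀ y z yS yM zS zM : B.Elem,
      IsSharpMeagerDecomp y.val yS.val yM.val → IsSharpMeagerDecomp z.val zS.val zM.val →
      ∃ a b c d ab abc m : B.Elem,
        IsGLB {yS, zS} a ∧ IsGLB {yS, zM} b ∧ IsGLB {zS, yM} c ∧ IsGLB {yM, zM} d ∧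
        PartialSum.oplus a b = some ab ∧ PartialSum.oplus ab c = some abc ∧
        PartialSum.oplus abc d = some m ∧ IsGLB {y, z} m := by
    intro y z yS yM zS zM hy hz
    have hR := hB.1
    have hsharp : ∀ s x : B.Elem, IsSharp s.val → ∃ a : B.Elem, IsGLB {s, x} a := by
      intro s x hs
      obtain ⟨a, ha, b, -, has, -, hab, hmax⟩ :=
        SubEffectAlgebra.exists_split_of_isSharp hR hs s.2 x.2
      exact ⟨⟨a, ha⟩, SubEffectAlgebra.Elem.isGLB_iff.2 ⟨has, le_of_add hab, hmax⟩⟩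
    obtain ⟨a, ha⟩ := hsharp yS zS hy.1
    obtain ⟨b, hb⟩ := hsharp yS zM hy.1
    obtain ⟨c, hc⟩ := hsharp zS yM hz.1
    obtain ⟨d, hd⟩ : ∃ d : B.Elem, IsGLB {yM, zM} d := by
      obtain ⟨m, hm, h⟩ := SubEffectAlgebra.exists_meet_of_isMeager hmea hR yM.2 zM.2 hy.2.1 hz.2.1
        fun t ht => (hB.mem_of_decomp hhom hmea hsd y.2 hy ht).2
      exact ⟨⟨m, hm⟩, SubEffectAlgebra.Elem.isGLB_iff.2 h⟩
    obtain ⟨ha₁, ha₂, ha₃⟩ := SubEffectAlgebra.Elem.isGLB_iff.1 ha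
    obtain ⟨hb₁, hb₂, hb₃⟩ := SubEffectAlgebra.Elem.isGLB_iff.1 hb
    obtain ⟨hc₁, hc₂, hc₃⟩ := SubEffectAlgebra.Elem.isGLB_iff.1 hc
    obtain ⟨hd₁, hd₂, hd₃⟩ := SubEffectAlgebra.Elem.isGLB_iff.1 hd
    obtain ⟨ab, hab, abc, habc, m, hm, e1, e2, e3, h⟩ := SubEffectAlgebra.isMeet_add hR
      yS.2 yM.2 zS.2 zM.2 hy hz a.2 b.2 c.2 d.2 ha₁ ha₂ ha₃ hb₁ hb₂ hb₃ hc₁ hc₂ hc₃ hd₁ hd₂ hd₃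
    exact ⟨a, b, c, d, ⟨ab, hab⟩, ⟨abc, habc⟩, ⟨m, hm⟩, ha, hb, hc, hd,
      restrictSum_eq_some.2 e1, restrictSum_eq_some.2 e2, restrictSum_eq_some.2 e3,
      SubEffectAlgebra.Elem.isGLB_iff.2 h⟩
  refine ⟨SubEffectAlgebra.isLatticeOrder_of_exists_isGLB fun y z => ?_, hdec, hmeet⟩
  obtain ⟨yS, yM, hy, -⟩ := hdec y
  obtain ⟨zS, zM, hz, -⟩ := hdec z
  obtain ⟨-, -, -, -, -, -, m, -, -, -, -, -, -, -, hm⟩ := hmeet y z yS yM zS zM hy hz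
  exact ⟨m, hm⟩
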